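/- For real $s$ and $x$ let $F_s(x)=\sum_{k=1}^{\infty} e^{i\pi k^2x}/k^s$ (convergence meaning convergence of the partial sums). Put $\rho=e^{i\pi/4}$, let $\sigma(x)$ be the sign of $x$, and let powers of complex numbers be principal. For $s\ge 0$ and $x>0$ set $$I_s(x)=\int_{1/2-\rho\infty}^{1/2+\rho\infty}\frac{e^{i\pi z^2x}}{z^s(1-e^{2i\pi z})}\,dz+\rho x^s\int_{-\infty}^{\infty}e^{-\pi xu^2}\sum_{k=1}^{\infty}e^{-i\pi k^2/x}\Big(\frac1{(\rho xu+k)^s}-\frac1{k^s}\Big)du,$$ the first integral being along a straight line, and let $\Omega_s(x)=I_s(x)$ if $x>0$, $\Omega_s(x)=\overline{I_s(-x)}$ if $x<0$. For $x\neq0$ let $T(x)\in[-1,1)$ be the representative of $-1/x$ modulo $2$, and let $T^j$ be the $j$-th iterate of $T$. For irrational $x$ let $(Q_n)_{n\ge0}$ be the denominators of the convergents of the regular continued fraction of $x$, and let $\mu(x)\in[1,\infty]$ be its irrationality exponent, the supremum of the $\mu\ge1$ such that for infinitely many integers $q\geq 1$ there is an integer $p$ with $|x-p/q|<q^{-\mu}$.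 (i) Let $1/2<s<1$. If $x\in(-1,1)$ is irrational and $$\sum_{n=1}^{\infty}\frac{Q_{n+1}^{(3-s)/2}}{Q_n^{1+s/2}}\qquad(1)$$ converges, then $F_s(x)$ converges and $$F_s(x)=\sum_{j=0}^{\infty}e^{i\frac{\pi}{4}\sum_{\ell=0}^{j-1}\sigma(T^\ell(x))}\,|xT(x)\cdots T^{j-1}(x)|^{s-\frac12}\,\Omega_s(T^j(x)),$$ the series on the right being convergent. The series (1) converges for every irrational $x$ such that $\mu(x)<1+\frac{2+s}{3-s}$. (ii) If $x\in(-1,1)$ is irrational and $$\sum_{n=1}^{\infty}\left(\frac{\log(Q_{n+1})}{\sqrt{Q_{n-1}}}+\frac{Q_{n+1}\log(Q_{n+1})^2}{Q_n^{3/2}}\right)\qquad(2)$$ converges, then $F_1(x)$ converges and $$F_1(x)=\sum_{j=0}^{\infty}e^{i\frac{\pi}{4}\sum_{\ell=0}^{j-1}\sigma(T^\ell(x))}\,\sqrt{|xT(x)\cdots T^{j-1}(x)|}\;\Omega_1(T^j(x)),$$ the series on the right being convergent. The series (2) converges for every irrational $x$ such that $\mu(x)<\frac52$. -/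

import Mathlib

open Filter Topology

noncomputable section

namespace ThetaSeries

/-- The `N`-th partial sum `∑_{k=1}^N e^{iπk²x} / k^s` of `F_s(x)`. -/
def partialF (s x : ℝ) (N : ℕ) : ℂ :=
  ∑ k ∈ Finset.Icc 1 N,
    Complex.exp (Complex.I * Real.pi * (k : ℂ) ^ 2 * x) / (((k : ℝ) ^ s : ℝ) : ℂ)

/-- `ρ = e^{iπ/4}`. -/
def rho : ℂ := Complex.exp (Complex.I * (Real.pi / 4))

/-- The integral of `e^{iπz²x} / (z^s (1 - e^{2iπz}))` along the straight line from `1/2 - ρ∞`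
to `1/2 + ρ∞`, parametrised by `z = 1/2 + ρu`, `u ∈ ℝ`. Powers are principal. -/
def lineIntegral (s x : ℝ) : ℂ :=
  ∫ u : ℝ,
    Complex.exp (Complex.I * Real.pi * (1 / 2 + rho * u) ^ 2 * x) /
      ((1 / 2 + rho * u) ^ (s : ℂ) *
        (1 - Complex.exp (2 * Complex.I * Real.pi * (1 / 2 + rho * u)))) * rho

/-- `∑_{k ≥ 1} e^{-iπk²/x} (1 / (ρxu + k)^s - 1 / k^s)`, an absolutely convergent series
(the summation index is `k = m + 1`). -/
def innerSeries (s x u : ℝ) : ℂ :=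
  ∑' m : ℕ,
    Complex.exp (-(Complex.I * Real.pi * ((m : ℂ) + 1) ^ 2 / x)) *
      (1 / (rho * x * u + ((m : ℂ) + 1)) ^ (s : ℂ) - 1 / ((m : ℂ) + 1) ^ (s : ℂ))

/-- `I_s(x)`, for `x > 0`. -/
def Ipos (s x : ℝ) : ℂ :=
  lineIntegral s x +
    rho * ((x ^ s : ℝ) : ℂ) *
      ∫ u : ℝ, ((Real.exp (-(Real.pi * x * u ^ 2)) : ℝ) : ℂ) * innerSeries s x u

/-- `Ω_s(x)`, for `x ≠ 0`: it is `I_s(x)` if `x > 0` and the conjugate of `I_s(-x)` if `x < 0`. -/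
def Omega (s x : ℝ) : ℂ :=
  if 0 < x then Ipos s x else (starRingEnd ℂ) (Ipos s (-x))

/-- `T(x) = -1/x mod 2`, for `x ≠ 0`, with representative in `[-1, 1)`. -/
def T (x : ℝ) : ℝ := -1 / x - 2 * (⌊(-1 / x + 1) / 2⌋ : ℝ)

/-- `|x T(x) ⋯ T^{j-1}(x)|`. -/
def absProd (x : ℝ) (j : ℕ) : ℝ := |∏ l ∈ Finset.range j, T^[l] x|

/-- `exp(i (π/4) ∑_{l=0}^{j-1} sign(T^l x))`. -/
def phase (x : ℝ) (j : ℕ) : ℂ :=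
  Complex.exp (Complex.I * (Real.pi / 4) * ((∑ l ∈ Finset.range j, Real.sign (T^[l] x) : ℝ) : ℂ))

/-- The denominator `Q_n` of the `n`-th convergent of the regular continued fraction of `x`
(`Q_0 = 1`, `Q_1 = A_1`, `Q_{n+1} = A_{n+1} Q_n + Q_{n-1}`). -/
def Q (x : ℝ) (n : ℕ) : ℝ := (GenContFract.of x).dens n

/-- The irrationality exponent `μ(x)`, as an extended real number (it may be `⊤`). -/
def irrationalityExponent (x : ℝ) : EReal :=
  sSup ((fun μ : ℝ => (μ : EReal)) ''
    {μ : ℝ | 1 ≤ μ ∧ {q : ℕ | 1 ≤ q ∧ ∃ p : ℤ, |x - (p : ℝ) / q| < 1 / (q : ℝ) ^ μ}.Infinite})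

/-- The series of complex numbers `∑_{j ≥ 0} a j` and the series `F_s(x)` both converge, as limits
of their partial sums, and have the same sum. -/
def FEqualsSeries (s x : ℝ) (a : ℕ → ℂ) : Prop :=
  ∃ F : ℂ, Tendsto (fun N : ℕ => partialF s x N) atTop (𝓝 F) ∧
    Tendsto (fun J : ℕ => ∑ j ∈ Finset.range J, a j) atTop (𝓝 F)

end ThetaSeries

end

/-!
Shifting the line of integration of `e^{iπz²x} / (z^s (1 - e^{2iπz}))` from `1/2` to `N + 1/2`
picks up the `N`-th partial sum of `F_s(x)` as residues. On the far line, subtracting the first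
`K ≈ x N` terms of the geometric expansion of the kernel leaves a negligible integral, and the term
`e^{iπz²x - 2iπkz} / z^s`, moved to the line through its saddle point `k / x`, gives
`e^{-iπk²/x} / k^s` up to an explicit error. Hence convergence of `F_s(-1/x)` implies that of
`F_s(x)`, with `F_s(x) = Ω_s(x) + e^{iπσ(x)/4} |x|^{s-1/2} F_s(-1/x)`.

Iterating this along the orbit of `x` under `T` produces the partial sums of the series on the
right, with remainder of modulus `|x T(x) ⋯ T^{J-1}(x)|^{s-1/2} |F_s(T^J(x))|`. Weyl differencing
bounds quadratic exponential sums at `T^J(x)` in terms of the rational approximations of `T^J(x)`,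
which the modular matrix taking `x` to `T^J(x)` carries to approximations of `x` itself. With `ψ(M)`
the least `q ≥ 1` such that `qx` is within `1/M` of an integer, summation by parts then shows that
the remainder tends to `0` once `M^{-s} / √ψ(M)` is integrable at infinity. Since `ψ(M) ≥ Q_n / 2`
for `M ≥ 2 Q_n`, the integral is at most a constant times
`∑ Q_n^{-1/2} ∫_{Q_n}^{Q_{n+1}} u^{-s} du`.
-/

open Filter Topology MeasureTheory Set Asymptotics
open scoped Real

noncomputable section

namespace ThetaSeries

section Contour

theorem integral_horizontal_line_eq {E : Type*} [NormedAddCommGroup E] [NormedSpace ℂ E]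
    {f : ℂ → E} {α β : ℝ} {G : ℝ → ℝ} (hf : DifferentiableOn ℂ f {z | z.im ∈ uIcc α β})
    (hα : Integrable fun t : ℝ => f (t + α * Complex.I))
    (hβ : Integrable fun t : ℝ => f (t + β * Complex.I))
    (hfG : ∀ z : ℂ, z.im ∈ uIcc α β → ‖f z‖ ≤ G |z.re|) (hG : Tendsto G atTop (𝓝 0)) :
    ∫ t : ℝ, f (t + α * Complex.I) = ∫ t : ℝ, f (t + β * Complex.I) := by
  have hhoriz : ∀ {γ : ℝ}, Integrable (fun t : ℝ => f (t + γ * Complex.I)) →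
      Tendsto (fun n : ℕ => ∫ t in (-n : ℝ)..n, f (t + γ * Complex.I)) atTop
        (𝓝 (∫ t : ℝ, f (t + γ * Complex.I))) := fun h =>
    intervalIntegral_tendsto_integral h (tendsto_neg_atTop_atBot.comp tendsto_natCast_atTop_atTop)
      tendsto_natCast_atTop_atTop
  have hvert : ∀ x : ℕ → ℝ, (∀ n, |x n| = n) →
      Tendsto (fun n : ℕ => ∫ y in α..β, f (x n + y * Complex.I)) atTop (𝓝 0) := by
    intro x hx
    refine squeeze_zero_norm (a := fun n : ℕ => G n * |β - α|) (fun n => ?_) ?_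
    · refine intervalIntegral.norm_integral_le_of_norm_le_const fun y hy => ?_
      simpa [hx n] using hfG (x n + y * Complex.I) (by simpa using uIoc_subset_uIcc hy)
    · simpa using (hG.comp tendsto_natCast_atTop_atTop).mul_const |β - α|
  have hrect : ∀ n : ℕ, (∫ t in (-n : ℝ)..n, f (t + α * Complex.I)) -
      (∫ t in (-n : ℝ)..n, f (t + β * Complex.I)) +
      Complex.I • (∫ y in α..β, f ((n : ℝ) + y * Complex.I)) -
      Complex.I • (∫ y in α..β, f ((-n : ℝ) + y * Complex.I)) = 0 := fun n => by
    simpa using Complex.integral_boundary_rect_eq_zero_of_differentiableOn f ⟨-n, α⟩ ⟨n, β⟩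
      (hf.mono fun z hz => hz.2)
  have hlim := (((hhoriz hα).sub (hhoriz hβ)).add
    ((hvert (fun n => n) (by simp)).const_smul Complex.I)).sub
    ((hvert (fun n => -n) (by simp)).const_smul Complex.I)
  have hzero := tendsto_nhds_unique (hlim.congr fun n => hrect n) tendsto_const_nhds
  rwa [smul_zero, add_zero, sub_zero, sub_eq_zero] at hzero

theorem rho_eq : rho = ((√2 / 2 : ℝ) : ℂ) * (1 + Complex.I) := by
  rw [rho, mul_comm, show (π / 4 : ℂ) = ((π / 4 : ℝ) : ℂ) by push_cast; rfl,
    Complex.exp_mul_I, ← Complex.ofReal_cos, ← Complex.ofReal_sin, Real.cos_pi_div_four,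
    Real.sin_pi_div_four]
  ring

theorem rho_re : rho.re = √2 / 2 := by simp [rho_eq]

theorem rho_im : rho.im = √2 / 2 := by simp [rho_eq]

theorem rho_sq : rho ^ 2 = Complex.I := by
  rw [rho, ← Complex.exp_nat_mul,
    show ((2 : ℕ) : ℂ) * (Complex.I * (π / 4)) = π / 2 * Complex.I by push_cast; ring]
  exact Complex.exp_pi_div_two_mul_I

theorem norm_rho : ‖rho‖ = 1 := by
  rw [rho, Complex.norm_exp]; simp

theorem rho_ne_zero : rho ≠ 0 := Complex.exp_ne_zero _

theorem half_sqrt_two_sq : (√2 / 2) ^ 2 = (1 / 2 : ℝ) := by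
  rw [div_pow, Real.sq_sqrt (by norm_num)]; norm_num

/-- The closed strip between the lines `a + ρℝ` and `b + ρℝ`. As `ρ` is a positive multiple of
`1 + i`, the line `a + ρℝ` is `Re z - Im z = a`. -/
def strip (a b : ℝ) : Set ℂ := {z | z.re - z.im ∈ Icc a b}

/-- `g` is `O(exp(-c (Im z)²))` on `S` for some `c > 0`. -/
def HasGaussianDecayOn (g : ℂ → ℂ) (S : Set ℂ) : Prop :=
  ∃ c > 0, g =O[𝓟 S] fun z => Real.exp (-c * z.im ^ 2)

variable {g h : ℂ → ℂ} {S : Set ℂ} {a b : ℝ}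

theorem mem_strip_iff {z : ℂ} : z ∈ strip a b ↔ a ≤ z.re - z.im ∧ z.re - z.im ≤ b := Iff.rfl

theorem strip_subset_strip {a' b' : ℝ} (ha : a ≤ a') (hb : b' ≤ b) : strip a' b' ⊆ strip a b :=
  fun _ hz => Icc_subset_Icc ha hb hz

theorem line_re (a u : ℝ) : ((a : ℂ) + rho * u).re = a + √2 / 2 * u := by
  simp [rho_re]

theorem line_im (a u : ℝ) : ((a : ℂ) + rho * u).im = √2 / 2 * u := by
  simp [rho_im]

theorem line_im_sq (a u : ℝ) : ((a : ℂ) + rho * u).im ^ 2 = u ^ 2 / 2 := by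
  rw [line_im, mul_pow, half_sqrt_two_sq]; ring

theorem line_re_sub_im (a u : ℝ) : ((a : ℂ) + rho * u).re - ((a : ℂ) + rho * u).im = a := by
  rw [line_re, line_im]; ring

theorem line_mem_strip (a u : ℝ) : (a : ℂ) + rho * u ∈ strip a a := by
  rw [mem_strip_iff, line_re_sub_im]
  exact ⟨le_rfl, le_rfl⟩

theorem HasGaussianDecayOn.mono {S' : Set ℂ} (hg : HasGaussianDecayOn g S) (hS : S' ⊆ S) :
    HasGaussianDecayOn g S' :=
  let ⟨c, hc, hO⟩ := hg
  ⟨c, hc, hO.mono (principal_mono.2 hS)⟩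

theorem HasGaussianDecayOn.sub (hg : HasGaussianDecayOn g S) (hh : HasGaussianDecayOn h S) :
    HasGaussianDecayOn (fun z => g z - h z) S := by
  obtain ⟨c, hc, hgO⟩ := hg
  obtain ⟨d, hd, hhO⟩ := hh
  have hweaken : ∀ {e : ℝ}, min c d ≤ e → (fun z : ℂ => Real.exp (-e * z.im ^ 2)) =O[𝓟 S]
      fun z => Real.exp (-min c d * z.im ^ 2) := fun he => by
    refine IsBigO.of_norm_le fun z => ?_
    rw [Real.norm_eq_abs, Real.abs_exp]
    gcongr
  exact ⟨min c d, lt_min hc hd, (hgO.trans (hweaken (min_le_left c d))).sub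
    (hhO.trans (hweaken (min_le_right c d)))⟩

theorem HasGaussianDecayOn.const_mul (hg : HasGaussianDecayOn g S) (w : ℂ) :
    HasGaussianDecayOn (fun z => w * g z) S :=
  let ⟨c, hc, hO⟩ := hg
  ⟨c, hc, hO.const_mul_left w⟩

theorem HasGaussianDecayOn.congr (hg : HasGaussianDecayOn g S) (hgh : EqOn g h S) :
    HasGaussianDecayOn h S :=
  let ⟨c, hc, hO⟩ := hg
  ⟨c, hc, hO.congr' (eventuallyEq_principal.2 hgh) EventuallyEq.rfl⟩

theorem HasGaussianDecayOn.div (hg : HasGaussianDecayOn g S) {ε : ℝ} (hε : 0 < ε)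
    (hh : ∀ z ∈ S, ε ≤ ‖h z‖) : HasGaussianDecayOn (fun z => g z / h z) S := by
  obtain ⟨c, hc, hO⟩ := hg
  have hquot : (fun z => g z / h z) =O[𝓟 S] g := by
    refine isBigO_principal.2 ⟨ε⁻¹, fun z hz => ?_⟩
    rw [norm_div, div_eq_inv_mul]
    gcongr
    exact hh z hz
  exact ⟨c, hc, hquot.trans hO⟩

theorem isCompact_strip_inter_abs_im_le (a b T : ℝ) :
    IsCompact (strip a b ∩ {z | |z.im| ≤ T}) := by
  have himage : IsCompact ((fun p : ℝ × ℝ => ((p.1 + p.2 : ℝ) : ℂ) + p.2 * Complex.I) ''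
      (Icc a b ×ˢ Icc (-T) T)) := (isCompact_Icc.prod isCompact_Icc).image (by fun_prop)
  convert himage using 1
  ext z
  constructor
  · rintro ⟨hz, hT⟩
    exact ⟨(z.re - z.im, z.im), ⟨hz, abs_le.1 hT⟩, by simp⟩
  · rintro ⟨⟨t, y⟩, ⟨ht, hy⟩, rfl⟩
    exact ⟨by simpa [strip] using ht, by simpa [abs_le] using hy⟩

theorem HasGaussianDecayOn.of_abs_im_ge {T : ℝ} (hg : ContinuousOn g (strip a b))
    (hdecay : HasGaussianDecayOn g (strip a b ∩ {z | T ≤ |z.im|})) :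
    HasGaussianDecayOn g (strip a b) := by
  obtain ⟨c, hc, hO⟩ := hdecay
  have hK := isCompact_strip_inter_abs_im_le a b T
  have hcompact : g =O[𝓟 (strip a b ∩ {z | |z.im| ≤ T})]
      fun z => Real.exp (-c * z.im ^ 2) := by
    refine ((hg.mono inter_subset_left).isBigO_principal hK (c := (1 : ℝ)) (by simp)).trans
      (ContinuousOn.isBigO_rev_principal (by fun_prop) hK (fun z _ => (Real.exp_pos _).ne') 1)
  refine ⟨c, hc, (hO.sup hcompact).mono ?_⟩
  rw [sup_principal, principal_mono, ← inter_union_distrib_left]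
  exact fun z hz => ⟨hz, le_total T |z.im|⟩

theorem integrable_line (hg : ContinuousOn g (strip a a))
    (hdecay : HasGaussianDecayOn g (strip a a)) : Integrable fun u : ℝ => g (a + rho * u) := by
  obtain ⟨c, hc, hO⟩ := hdecay
  obtain ⟨C, hC⟩ := isBigO_principal.1 hO
  have hcont : Continuous fun u : ℝ => g (a + rho * u) :=
    hg.comp_continuous (by fun_prop) (line_mem_strip a)
  refine ((integrable_exp_neg_mul_sq (half_pos hc)).const_mul C).mono'
    hcont.aestronglyMeasurable (ae_of_all _ fun u => ?_)
  have hu := hC _ (line_mem_strip a u)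
  rw [line_im_sq, Real.norm_eq_abs, Real.abs_exp] at hu
  convert hu using 3
  ring

theorem line_eq_one_add_I_mul (a u : ℝ) : (a : ℂ) + rho * u =
    (1 + Complex.I) * ((√2 / 2 * u + a / 2 : ℝ) + (-(a / 2) : ℝ) * Complex.I) := by
  rw [rho_eq]
  push_cast
  linear_combination (a / 2 : ℂ) * Complex.I_sq

theorem integral_line_eq_integral_horizontal_line (g : ℂ → ℂ) (a : ℝ) :
    ∫ u : ℝ, g (a + rho * u) = |(√2 / 2)⁻¹| •
      ∫ t : ℝ, g ((1 + Complex.I) * (t + (-(a / 2) : ℝ) * Complex.I)) := by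
  simp_rw [line_eq_one_add_I_mul]
  rw [Measure.integral_comp_mul_left
    (fun t : ℝ => g ((1 + Complex.I) * ((t + a / 2 : ℝ) + (-(a / 2) : ℝ) * Complex.I)))]
  rw [integral_add_right_eq_self
    (fun t : ℝ => g ((1 + Complex.I) * (t + (-(a / 2) : ℝ) * Complex.I)))]

theorem integrable_horizontal_line (hg : ContinuousOn g (strip a a))
    (hdecay : HasGaussianDecayOn g (strip a a)) :
    Integrable fun t : ℝ => g ((1 + Complex.I) * (t + (-(a / 2) : ℝ) * Complex.I)) := by
  have hline := integrable_line hg hdecay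
  simp_rw [line_eq_one_add_I_mul] at hline
  have hshift := (integrable_comp_mul_left_iff
    (fun t : ℝ => g ((1 + Complex.I) * ((t + a / 2 : ℝ) + (-(a / 2) : ℝ) * Complex.I)))
    (by positivity : √2 / 2 ≠ 0)).1 hline
  simpa only [sub_add_cancel] using hshift.comp_sub_right (a / 2)

theorem one_add_I_mul_mem_strip {ζ : ℂ} (hab : a ≤ b) (hζ : ζ.im ∈ uIcc (-(a / 2)) (-(b / 2))) :
    (1 + Complex.I) * ζ ∈ strip a b := by
  rw [uIcc_of_ge (by linarith)] at hζ
  rw [mem_strip_iff]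
  simp only [Complex.mul_re, Complex.mul_im, Complex.add_re, Complex.add_im, Complex.one_re,
    Complex.one_im, Complex.I_re, Complex.I_im]
  constructor <;> linarith [hζ.1, hζ.2]

theorem HasGaussianDecayOn.exists_norm_le_of_strip (hab : a ≤ b)
    (hdecay : HasGaussianDecayOn g (strip a b)) :
    ∃ C : ℝ, ∃ c > 0, ∀ ζ : ℂ, ζ.im ∈ uIcc (-(a / 2)) (-(b / 2)) →
      ‖g ((1 + Complex.I) * ζ)‖ ≤ C * Real.exp (-c * |ζ.re| ^ 2) := by
  obtain ⟨c, hc, hO⟩ := hdecay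
  obtain ⟨C, hC0, hC⟩ := hO.exists_nonneg
  rw [isBigOWith_principal] at hC
  refine ⟨C * Real.exp (c * (|a| + |b|) ^ 2), c / 2, half_pos hc, fun ζ hζ => ?_⟩
  refine (hC _ (one_add_I_mul_mem_strip hab hζ)).trans ?_
  rw [uIcc_of_ge (by linarith)] at hζ
  have hζim : |ζ.im| ≤ |a| + |b| := abs_le.2
    ⟨by linarith [hζ.1, le_abs_self b, abs_nonneg a, abs_nonneg b],
      by linarith [hζ.2, neg_le_abs a, abs_nonneg a, abs_nonneg b]⟩
  have hζsq : ζ.im ^ 2 ≤ (|a| + |b|) ^ 2 := by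
    rw [← sq_abs]
    gcongr
  have him : ((1 + Complex.I) * ζ).im = ζ.re + ζ.im := by simp [add_comm]
  rw [Real.norm_eq_abs, Real.abs_exp, mul_assoc, ← Real.exp_add, sq_abs, him]
  gcongr
  nlinarith [sq_nonneg (ζ.re + 2 * ζ.im)]

theorem integral_line_eq_of_strip (hab : a ≤ b) (hg : DifferentiableOn ℂ g (strip a b))
    (hdecay : HasGaussianDecayOn g (strip a b)) :
    ∫ u : ℝ, g (a + rho * u) = ∫ u : ℝ, g (b + rho * u) := by
  have hint : ∀ α ∈ Icc a b, Integrable fun t : ℝ =>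
      g ((1 + Complex.I) * (t + (-(α / 2) : ℝ) * Complex.I)) := fun α hα => by
    have hsub : strip α α ⊆ strip a b := strip_subset_strip hα.1 hα.2
    exact integrable_horizontal_line (hg.continuousOn.mono hsub) (hdecay.mono hsub)
  obtain ⟨C, c, hc, hbound⟩ := hdecay.exists_norm_le_of_strip hab
  have hexp : Tendsto (fun t : ℝ => C * Real.exp (-c * t ^ 2)) atTop (𝓝 0) := by
    simpa using (Real.tendsto_exp_atBot.comp
      ((tendsto_pow_atTop two_ne_zero).const_mul_atTop_of_neg (neg_lt_zero.2 hc))).const_mul C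
  rw [integral_line_eq_integral_horizontal_line, integral_line_eq_integral_horizontal_line,
    integral_horizontal_line_eq (f := fun ζ => g ((1 + Complex.I) * ζ))
      (hg.comp (by fun_prop) fun ζ hζ => one_add_I_mul_mem_strip hab hζ)
      (hint a (left_mem_Icc.2 hab)) (hint b (right_mem_Icc.2 hab)) hbound hexp]

end Contour

section Residue

/-- The denominator `1 - e^{2iπz}` of the Mordell integrals, which vanishes exactly at the
integers. -/
def mordellDenom (z : ℂ) : ℂ := 1 - Complex.exp (2 * Complex.I * π * z)

variable {g : ℂ → ℂ} {z : ℂ}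

theorem differentiable_mordellDenom : Differentiable ℂ mordellDenom := by
  unfold mordellDenom; fun_prop

theorem mordellDenom_eq_zero_iff : mordellDenom z = 0 ↔ ∃ n : ℤ, z = n := by
  rw [mordellDenom, sub_eq_zero, eq_comm, Complex.exp_eq_one_iff]
  refine exists_congr fun n => ?_
  rw [show 2 * Complex.I * π * z = z * (2 * π * Complex.I) by ring]
  exact mul_left_inj' Complex.two_pi_I_ne_zero

theorem mordellDenom_intCast (n : ℤ) : mordellDenom n = 0 := mordellDenom_eq_zero_iff.2 ⟨n, rfl⟩

theorem exp_two_pi_I_mul_intCast (n : ℤ) : Complex.exp (2 * Complex.I * π * n) = 1 :=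
  (sub_eq_zero.1 (mordellDenom_intCast n)).symm

theorem mordellDenom_add_one (z : ℂ) : mordellDenom (z + 1) = mordellDenom z := by
  have h := exp_two_pi_I_mul_intCast 1
  push_cast at h
  rw [mordellDenom, mordellDenom, mul_add, Complex.exp_add, h, mul_one]

theorem deriv_mordellDenom_intCast (n : ℤ) : deriv mordellDenom n = -(2 * Complex.I * π) := by
  have h : HasDerivAt mordellDenom (-(Complex.exp (2 * Complex.I * π * n) *
      (2 * Complex.I * π * 1))) (n : ℂ) :=
    (((hasDerivAt_id (n : ℂ)).const_mul (2 * Complex.I * π)).cexp).const_sub 1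
  rw [h.deriv, exp_two_pi_I_mul_intCast, one_mul, mul_one]

theorem half_le_norm_mordellDenom_of_le_abs_im (hz : 1 / 4 ≤ |z.im|) :
    1 / 2 ≤ ‖mordellDenom z‖ := by
  have hw : ‖Complex.exp (2 * Complex.I * π * z)‖ = Real.exp (-(2 * π * z.im)) := by
    simp [Complex.norm_exp]
  have hexp_one : 2 ≤ Real.exp 1 := by linarith [Real.add_one_le_exp 1]
  have hpi := Real.pi_gt_three
  have hdist := abs_norm_sub_norm_le (1 : ℂ) (Complex.exp (2 * Complex.I * π * z))
  rw [norm_one, hw, ← mordellDenom] at hdist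
  refine le_trans ?_ hdist
  rcases le_abs.1 hz with h | h
  · have hsmall : Real.exp (-(2 * π * z.im)) ≤ (Real.exp 1)⁻¹ := by
      rw [← Real.exp_neg]
      exact Real.exp_le_exp.2 (by nlinarith)
    have hinv : (Real.exp 1)⁻¹ ≤ 1 / 2 := by
      rw [one_div]; exact inv_anti₀ two_pos hexp_one
    exact le_abs.2 (.inl (by linarith))
  · have hlarge : Real.exp 1 ≤ Real.exp (-(2 * π * z.im)) := Real.exp_le_exp.2 (by nlinarith)
    exact le_abs.2 (.inr (by linarith))

theorem half_le_norm_mordellDenom_of_re_sub_im {n : ℤ} (hz : z.re - z.im = n + 1 / 2) :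
    1 / 2 ≤ ‖mordellDenom z‖ := by
  by_cases h : 1 / 4 ≤ |z.im|
  · exact half_le_norm_mordellDenom_of_le_abs_im h
  have him := abs_lt.1 (not_le.1 h)
  have hre : (mordellDenom z).re =
      1 + Real.exp (-(2 * π * z.im)) * Real.cos (2 * π * z.im) := by
    have hcos : Real.cos (2 * π * z.re) = -Real.cos (2 * π * z.im) := by
      rw [show 2 * π * z.re = 2 * π * z.im + π + n * (2 * π) by linear_combination 2 * π * hz,
        Real.cos_add_int_mul_two_pi, Real.cos_add_pi]
    simp [mordellDenom, Complex.exp_re, hcos]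
  have hcos : 0 ≤ Real.cos (2 * π * z.im) := by
    have := Real.pi_pos
    refine Real.cos_nonneg_of_neg_pi_div_two_le_of_le ?_ ?_ <;> nlinarith
  have hprod := mul_nonneg (Real.exp_pos (-(2 * π * z.im))).le hcos
  linarith [Complex.re_le_norm (mordellDenom z)]

theorem half_le_norm_mordellDenom_line {a : ℝ} {n : ℤ} (ha : a = n + 1 / 2) (u : ℝ) :
    1 / 2 ≤ ‖mordellDenom (a + rho * u)‖ :=
  half_le_norm_mordellDenom_of_re_sub_im ((line_re_sub_im a u).trans ha)

theorem mordellDenom_line_ne_zero {a : ℝ} {n : ℤ} (ha : a = n + 1 / 2) (u : ℝ) :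
    mordellDenom (a + rho * u) ≠ 0 :=
  norm_pos_iff.1 (one_half_pos.trans_le (half_le_norm_mordellDenom_line ha u))

theorem integrable_div_mordellDenom_line {a : ℝ} {n : ℤ} (ha : a = n + 1 / 2)
    (hg : ContinuousOn g (strip a a)) (hdecay : HasGaussianDecayOn g (strip a a)) :
    Integrable fun u : ℝ => g (a + rho * u) / mordellDenom (a + rho * u) := by
  have hden : ∀ z ∈ strip a a, 1 / 2 ≤ ‖mordellDenom z‖ := fun z hz =>
    half_le_norm_mordellDenom_of_re_sub_im ((le_antisymm hz.2 hz.1).trans ha)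
  exact integrable_line (hg.div differentiable_mordellDenom.continuous.continuousOn fun z hz =>
    norm_pos_iff.1 (one_half_pos.trans_le (hden z hz))) (hdecay.div one_half_pos hden)

theorem eq_intCast_of_mem_strip_of_mordellDenom_eq_zero {n : ℤ}
    (hz : z ∈ strip (n - 1 / 2) (n + 1 / 2)) (h : mordellDenom z = 0) : z = n := by
  obtain ⟨m, rfl⟩ := mordellDenom_eq_zero_iff.1 h
  simp only [mem_strip_iff, Complex.intCast_re, Complex.intCast_im, sub_zero] at hz
  have hlt : (n : ℝ) - 1 < m := by linarith [hz.1]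
  have hgt : (m : ℝ) < n + 1 := by linarith [hz.2]
  have hlt' : n - 1 < m := by exact_mod_cast hlt
  have hgt' : m < n + 1 := by exact_mod_cast hgt
  rw [show m = n by omega]

theorem strip_mem_nhds_intCast (n : ℤ) : strip (n - 1 / 2) (n + 1 / 2) ∈ 𝓝 (n : ℂ) := by
  have hcont : ContinuousAt (fun z : ℂ => z.re - z.im) n := by fun_prop
  refine hcont.preimage_mem_nhds (Icc_mem_nhds ?_ ?_) <;>
    simp only [Complex.intCast_re, Complex.intCast_im] <;> linarith

theorem dslope_div_dslope_mordellDenom {n : ℤ} (hgn : g n = 0) (hz : z ≠ n) :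
    dslope g n z / dslope mordellDenom n z = g z / mordellDenom z := by
  rw [dslope_of_ne _ hz, dslope_of_ne _ hz, slope_def_field, slope_def_field, hgn,
    mordellDenom_intCast, sub_zero, sub_zero, div_div_div_cancel_right₀ (sub_ne_zero.2 hz)]

theorem differentiableOn_dslope_div_dslope_mordellDenom {n : ℤ}
    (hg : DifferentiableOn ℂ g (strip (n - 1 / 2) (n + 1 / 2))) :
    DifferentiableOn ℂ (fun z => dslope g n z / dslope mordellDenom n z)
      (strip (n - 1 / 2) (n + 1 / 2)) := by
  have hnhds := strip_mem_nhds_intCast n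
  refine ((Complex.differentiableOn_dslope hnhds).2 hg).div
    ((Complex.differentiableOn_dslope hnhds).2 differentiable_mordellDenom.differentiableOn)
    fun z hz => ?_
  by_cases hzn : z = n
  · rw [hzn, dslope_same, deriv_mordellDenom_intCast]
    simp [Real.pi_ne_zero]
  · rw [dslope_of_ne _ hzn, slope_def_field, mordellDenom_intCast, sub_zero]
    exact div_ne_zero (fun h => hzn (eq_intCast_of_mem_strip_of_mordellDenom_eq_zero hz h))
      (sub_ne_zero.2 hzn)

theorem hasGaussianDecayOn_dslope_div_dslope_mordellDenom {n : ℤ}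
    (hg : DifferentiableOn ℂ g (strip (n - 1 / 2) (n + 1 / 2)))
    (hdecay : HasGaussianDecayOn g (strip (n - 1 / 2) (n + 1 / 2))) (hgn : g n = 0) :
    HasGaussianDecayOn (fun z => dslope g n z / dslope mordellDenom n z)
      (strip (n - 1 / 2) (n + 1 / 2)) := by
  refine .of_abs_im_ge (T := 1) (differentiableOn_dslope_div_dslope_mordellDenom hg).continuousOn ?_
  refine ((hdecay.mono inter_subset_left).div one_half_pos fun z hz =>
    half_le_norm_mordellDenom_of_le_abs_im (le_trans (by norm_num) hz.2)).congr fun z hz => ?_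
  refine (dslope_div_dslope_mordellDenom hgn ?_).symm
  rintro rfl
  have himz : (1 : ℝ) ≤ |(n : ℂ).im| := hz.2
  norm_num at himz

theorem integral_div_mordellDenom_line_eq_of_eq_zero {n : ℤ}
    (hg : DifferentiableOn ℂ g (strip (n - 1 / 2) (n + 1 / 2)))
    (hdecay : HasGaussianDecayOn g (strip (n - 1 / 2) (n + 1 / 2))) (hgn : g n = 0) :
    ∫ u : ℝ, g ((n - 1 / 2 : ℝ) + rho * u) / mordellDenom ((n - 1 / 2 : ℝ) + rho * u) =
      ∫ u : ℝ, g ((n + 1 / 2 : ℝ) + rho * u) / mordellDenom ((n + 1 / 2 : ℝ) + rho * u) := by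
  have hquot : ∀ a : ℝ, a ≠ n → ∀ u : ℝ,
      dslope g n (a + rho * u) / dslope mordellDenom n (a + rho * u) =
        g (a + rho * u) / mordellDenom (a + rho * u) := fun a ha u => by
    refine dslope_div_dslope_mordellDenom hgn fun h => ha ?_
    simpa [h] using (line_re_sub_im a u).symm
  have hcauchy := integral_line_eq_of_strip (by linarith)
    (differentiableOn_dslope_div_dslope_mordellDenom hg)
    (hasGaussianDecayOn_dslope_div_dslope_mordellDenom hg hdecay hgn)
  simpa only [hquot _ (by linarith : (n - 1 / 2 : ℝ) < n).ne,
    hquot _ (by linarith : (n : ℝ) < n + 1 / 2).ne'] using hcauchy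

/-- An entire function with value `1` at `n` and Gaussian decay on strips, for which the jump
of the Mordell integral across `n` is an explicit Gaussian integral. -/
def bump (n : ℤ) (z : ℂ) : ℂ :=
  Complex.exp (Complex.I * π * (z - n) ^ 2 + Complex.I * π * (z - n))

theorem bump_self (n : ℤ) : bump n n = 1 := by simp [bump]

theorem differentiable_bump (n : ℤ) : Differentiable ℂ (bump n) := by
  unfold bump; fun_prop

theorem hasGaussianDecayOn_bump (n : ℤ) (a b : ℝ) : HasGaussianDecayOn (bump n) (strip a b) := by
  set K : ℝ := |a - n| + |b - n| + 1
  refine ⟨π, Real.pi_pos, isBigO_principal.2 ⟨Real.exp (π * K ^ 2), fun z hz => ?_⟩⟩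
  have hre : (Complex.I * π * (z - n) ^ 2 + Complex.I * π * (z - n)).re =
      -π * z.im ^ 2 - π * (z.im ^ 2 + (2 * (z.re - z.im - n) + 1) * z.im) := by
    simp only [pow_two, Complex.add_re, Complex.sub_re, Complex.sub_im, Complex.mul_re,
      Complex.mul_im, Complex.I_re, Complex.I_im, Complex.ofReal_re, Complex.ofReal_im,
      Complex.intCast_re, Complex.intCast_im]
    ring
  have hK : (2 * (z.re - z.im - n) + 1) ^ 2 ≤ (2 * K) ^ 2 := by
    refine sq_le_sq' ?_ ?_
    · linarith [hz.1, neg_abs_le (a - n), abs_nonneg (b - n)]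
    · linarith [hz.2, le_abs_self (b - n), abs_nonneg (a - n)]
  have hsq : -(z.im ^ 2 + (2 * (z.re - z.im - n) + 1) * z.im) ≤ K ^ 2 := by
    nlinarith [sq_nonneg (z.im + (2 * (z.re - z.im - n) + 1) / 2)]
  rw [bump, Complex.norm_exp, Real.norm_eq_abs, Real.abs_exp, ← Real.exp_add, hre]
  refine Real.exp_le_exp.2 ?_
  nlinarith [mul_le_mul_of_nonneg_left hsq Real.pi_pos.le]

theorem bump_add_one (n : ℤ) (z : ℂ) :
    bump n (z + 1) = bump n z * Complex.exp (2 * Complex.I * π * z) := by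
  rw [bump, bump, ← Complex.exp_add,
    show Complex.I * π * (z + 1 - n) ^ 2 + Complex.I * π * (z + 1 - n) =
      (Complex.I * π * (z - n) ^ 2 + Complex.I * π * (z - n) + 2 * Complex.I * π * z) +
        2 * Complex.I * π * ((1 - n : ℤ) : ℂ) by push_cast; ring,
    Complex.exp_add, exp_two_pi_I_mul_intCast, mul_one]

theorem integrable_bump_div_mordellDenom_line (n : ℤ) {a : ℝ} {m : ℤ} (ha : a = m + 1 / 2) :
    Integrable fun u : ℝ => bump n (a + rho * u) / mordellDenom (a + rho * u) :=
  integrable_div_mordellDenom_line ha (differentiable_bump n).continuous.continuousOn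
    (hasGaussianDecayOn_bump n a a)

theorem bump_div_mordellDenom_line_sub (n : ℤ) (u : ℝ) :
    bump n ((n - 1 / 2 : ℝ) + rho * u) / mordellDenom ((n - 1 / 2 : ℝ) + rho * u) -
      bump n ((n + 1 / 2 : ℝ) + rho * u) / mordellDenom ((n + 1 / 2 : ℝ) + rho * u) =
      rho⁻¹ * ((Real.exp (-π * u ^ 2) : ℝ) : ℂ) := by
  have hden : mordellDenom ((n - 1 / 2 : ℝ) + rho * u) ≠ 0 :=
    mordellDenom_line_ne_zero (n := n - 1) (by push_cast; ring) u
  have hshift : ((n + 1 / 2 : ℝ) : ℂ) + rho * u = ((n - 1 / 2 : ℝ) + rho * u) + 1 := by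
    push_cast; ring
  rw [hshift, mordellDenom_add_one, bump_add_one, ← sub_div, ← mul_one_sub, ← mordellDenom,
    mul_div_cancel_right₀ _ hden, bump, rho, ← Complex.exp_neg, Complex.ofReal_exp,
    ← Complex.exp_add, ← rho]
  congr 1
  push_cast
  linear_combination (Complex.I * π * u ^ 2) * rho_sq + π * u ^ 2 * Complex.I_sq

theorem integral_bump_div_mordellDenom_line_sub (n : ℤ) :
    (∫ u : ℝ, bump n ((n - 1 / 2 : ℝ) + rho * u) / mordellDenom ((n - 1 / 2 : ℝ) + rho * u)) -
      (∫ u : ℝ, bump n ((n + 1 / 2 : ℝ) + rho * u) / mordellDenom ((n + 1 / 2 : ℝ) + rho * u)) =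
      rho⁻¹ := by
  rw [← integral_sub (integrable_bump_div_mordellDenom_line n (m := n - 1) (by push_cast; ring))
    (integrable_bump_div_mordellDenom_line n rfl)]
  simp_rw [bump_div_mordellDenom_line_sub]
  rw [integral_const_mul, integral_complex_ofReal, integral_gaussian, div_self Real.pi_ne_zero,
    Real.sqrt_one, Complex.ofReal_one, mul_one]

-- Subtracting `g n` times `bump n` removes the pole at `n`.
theorem integral_div_mordellDenom_line_sub {n : ℤ}
    (hg : DifferentiableOn ℂ g (strip (n - 1 / 2) (n + 1 / 2)))
    (hdecay : HasGaussianDecayOn g (strip (n - 1 / 2) (n + 1 / 2))) :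
    (∫ u : ℝ, g ((n - 1 / 2 : ℝ) + rho * u) / mordellDenom ((n - 1 / 2 : ℝ) + rho * u)) -
      (∫ u : ℝ, g ((n + 1 / 2 : ℝ) + rho * u) / mordellDenom ((n + 1 / 2 : ℝ) + rho * u)) =
      rho⁻¹ * g n := by
  have hzero := integral_div_mordellDenom_line_eq_of_eq_zero
    (hg.sub ((differentiable_bump n).const_mul (g n)).differentiableOn)
    (hdecay.sub ((hasGaussianDecayOn_bump n _ _).const_mul (g n)))
    (by simp [bump_self])
  have hsplit : ∀ a : ℝ, (∃ m : ℤ, a = m + 1 / 2) → a ∈ Icc (n - 1 / 2 : ℝ) (n + 1 / 2) →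
      ∫ u : ℝ, (g (a + rho * u) - g n * bump n (a + rho * u)) / mordellDenom (a + rho * u) =
        (∫ u : ℝ, g (a + rho * u) / mordellDenom (a + rho * u)) -
          g n * ∫ u : ℝ, bump n (a + rho * u) / mordellDenom (a + rho * u) := by
    rintro a ⟨m, hm⟩ ha
    have hsub : strip a a ⊆ strip (n - 1 / 2) (n + 1 / 2) := strip_subset_strip ha.1 ha.2
    rw [← integral_const_mul, ← integral_sub
      (integrable_div_mordellDenom_line hm (hg.continuousOn.mono hsub) (hdecay.mono hsub))
      ((integrable_bump_div_mordellDenom_line n hm).const_mul (g n))]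
    simp only [sub_div, mul_div_assoc]
  have hleft := hsplit (n - 1 / 2) ⟨n - 1, by push_cast; ring⟩ ⟨le_rfl, by linarith⟩
  have hright := hsplit (n + 1 / 2) ⟨n, rfl⟩ ⟨by linarith, le_rfl⟩
  have hbump := integral_bump_div_mordellDenom_line_sub n
  linear_combination hzero - hleft + hright + g n * hbump

end Residue

section MordellIntegral

variable {s x κ a b : ℝ}

/-- The integrand `e^{iπz²x - 2iπκz} / z^s` of the Mordell integral, without its periodic
denominator. -/
def mordellKernel (s x κ : ℝ) (z : ℂ) : ℂ :=
  Complex.exp (Complex.I * π * z ^ 2 * x - 2 * Complex.I * π * κ * z) * z ^ (-(s : ℂ))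

/-- The Mordell integral of `e^{iπz²x - 2iπκz} / (z^s (1 - e^{2iπz}))` along the line `a + ρℝ`. -/
def mordellIntegral (s x κ a : ℝ) : ℂ :=
  ∫ u : ℝ, mordellKernel s x κ (a + rho * u) / mordellDenom (a + rho * u) * rho

theorem lineIntegral_eq_mordellIntegral (s x : ℝ) :
    lineIntegral s x = mordellIntegral s x 0 (1 / 2) := by
  simp only [lineIntegral, mordellIntegral, mordellKernel, mordellDenom, Complex.cpow_neg]
  push_cast
  congr! 3 with u
  rw [← div_eq_mul_inv, div_div]
  ring_nf

theorem re_sub_im_le_two_mul_norm (z : ℂ) : z.re - z.im ≤ 2 * ‖z‖ := by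
  linarith [Complex.re_le_norm z, neg_le_of_abs_le (Complex.abs_im_le_norm z)]

theorem mem_slitPlane_of_im_lt_re {z : ℂ} (h : z.im < z.re) : z ∈ Complex.slitPlane := by
  refine Complex.mem_slitPlane_iff.2 (or_iff_not_imp_right.2 fun hz => ?_)
  rwa [not_not.1 hz] at h

theorem norm_cpow_neg_le (hs : 0 ≤ s) (ha : 0 < a) {z : ℂ} (hz : a ≤ z.re - z.im) :
    ‖z ^ (-(s : ℂ))‖ ≤ (a / 2) ^ (-s) := by
  rw [← Complex.ofReal_neg, Complex.norm_cpow_real]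
  exact Real.rpow_le_rpow_of_nonpos (half_pos ha) (by linarith [re_sub_im_le_two_mul_norm z])
    (neg_nonpos.2 hs)

theorem norm_mordellKernel_le (hs : 0 ≤ s) (hx : 0 < x) (ha : 0 < a) {z : ℂ}
    (hz : a ≤ z.re - z.im) :
    ‖mordellKernel s x κ z‖ ≤ (a / 2) ^ (-s) * Real.exp (π * (κ - x * (z.re - z.im)) ^ 2 / x) *
      Real.exp (-(π * x) * z.im ^ 2) := by
  rw [mordellKernel, norm_mul, mul_comm ‖_‖, Complex.norm_exp, mul_assoc (_ ^ _), ← Real.exp_add]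
  refine mul_le_mul (norm_cpow_neg_le hs ha hz) (Real.exp_le_exp.2 ?_) (Real.exp_pos _).le
    (by positivity)
  have hre : (Complex.I * π * z ^ 2 * x - 2 * Complex.I * π * κ * z).re
      = -(2 * π * x * z.re * z.im) + 2 * π * κ * z.im := by
    simp only [pow_two, Complex.sub_re, Complex.mul_re, Complex.mul_im, Complex.I_re, Complex.I_im,
      Complex.ofReal_re, Complex.ofReal_im, Complex.re_ofNat, Complex.im_ofNat]
    ring
  have hsquare : π * (κ - x * (z.re - z.im)) ^ 2 / x + -(π * x) * z.im ^ 2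
      - (-(2 * π * x * z.re * z.im) + 2 * π * κ * z.im)
      = π / x * (κ - x * (z.re - z.im) - x * z.im) ^ 2 := by
    field_simp; ring
  rw [hre]
  exact sub_nonneg.1 (hsquare ▸ by positivity)

theorem hasGaussianDecayOn_mordellKernel (hs : 0 ≤ s) (hx : 0 < x) (κ : ℝ) (ha : 0 < a) :
    HasGaussianDecayOn (mordellKernel s x κ) (strip a b) := by
  refine ⟨π * x, by positivity, isBigO_principal.2
    ⟨(a / 2) ^ (-s) * Real.exp (π * (|κ| + x * b) ^ 2 / x), fun z hz => ?_⟩⟩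
  have hlower : 0 ≤ x * (z.re - z.im) := mul_nonneg hx.le (ha.le.trans hz.1)
  have hupper : x * (z.re - z.im) ≤ x * b := mul_le_mul_of_nonneg_left hz.2 hx.le
  have hsq : (κ - x * (z.re - z.im)) ^ 2 ≤ (|κ| + x * b) ^ 2 :=
    sq_le_sq' (by linarith [neg_abs_le κ]) (by linarith [le_abs_self κ])
  rw [Real.norm_of_nonneg (Real.exp_pos _).le]
  exact (norm_mordellKernel_le hs hx ha hz.1).trans (by gcongr)

theorem differentiableOn_mordellKernel (ha : 0 < a) :
    DifferentiableOn ℂ (mordellKernel s x κ) (strip a b) := fun z hz => by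
  have hslit : z ∈ Complex.slitPlane := mem_slitPlane_of_im_lt_re (sub_pos.1 (ha.trans_le hz.1))
  refine DifferentiableAt.differentiableWithinAt (DifferentiableAt.mul (by fun_prop) ?_)
  exact ((hasStrictDerivAt_id z).hasDerivAt.cpow_const hslit).differentiableAt

theorem integral_mordellKernel_line_eq (hs : 0 ≤ s) (hx : 0 < x) (ha : 0 < a) (hb : 0 < b) :
    ∫ u : ℝ, mordellKernel s x κ (a + rho * u) = ∫ u : ℝ, mordellKernel s x κ (b + rho * u) := by
  wlog hab : a ≤ b generalizing a b
  · exact (this hb ha (le_of_not_ge hab)).symm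
  exact integral_line_eq_of_strip hab (differentiableOn_mordellKernel ha)
    (hasGaussianDecayOn_mordellKernel hs hx κ ha)

theorem integrable_mordellKernel_div_mordellDenom_line {n : ℤ} (hn : a = n + 1 / 2) (hs : 0 ≤ s)
    (hx : 0 < x) (ha : 0 < a) :
    Integrable fun u : ℝ => mordellKernel s x κ (a + rho * u) / mordellDenom (a + rho * u) :=
  integrable_div_mordellDenom_line hn (differentiableOn_mordellKernel ha).continuousOn
    (hasGaussianDecayOn_mordellKernel hs hx κ ha)

theorem mordellIntegral_sub_of_residue (hs : 0 ≤ s) (hx : 0 < x) (n : ℕ) :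
    mordellIntegral s x κ (n + 1 / 2) - mordellIntegral s x κ ((n + 1 : ℕ) + 1 / 2) =
      mordellKernel s x κ (n + 1) := by
  have ha : (0 : ℝ) < ((n + 1 : ℤ) : ℝ) - 1 / 2 := by push_cast; linarith [n.cast_nonneg (α := ℝ)]
  have hres := integral_div_mordellDenom_line_sub (differentiableOn_mordellKernel ha)
    (hasGaussianDecayOn_mordellKernel (s := s) hs hx κ ha)
  have hshift : ((n + 1 : ℤ) : ℝ) - 1 / 2 = n + 1 / 2 := by push_cast; ring
  rw [hshift] at hres
  rw [mordellIntegral, mordellIntegral, integral_mul_const, integral_mul_const, ← sub_mul]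
  push_cast at hres ⊢
  rw [hres]
  field_simp [rho_ne_zero]

theorem mordellKernel_eq_mul_exp (s x κ : ℝ) (z : ℂ) :
    mordellKernel s x κ z =
      mordellKernel s x (κ + 1) z * Complex.exp (2 * Complex.I * π * z) := by
  rw [mordellKernel, mordellKernel, mul_right_comm (Complex.exp _), ← Complex.exp_add]
  congr 2
  push_cast
  ring

theorem mordellIntegral_sub_of_kernel {n : ℤ} (hn : a = n + 1 / 2) (hs : 0 ≤ s) (hx : 0 < x)
    (ha : 0 < a) :
    mordellIntegral s x (κ + 1) a - mordellIntegral s x κ a =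
      rho * ∫ u : ℝ, mordellKernel s x (κ + 1) (a + rho * u) := by
  rw [mordellIntegral, mordellIntegral, integral_mul_const, integral_mul_const, ← sub_mul,
    mul_comm, ← integral_sub (integrable_mordellKernel_div_mordellDenom_line hn hs hx ha)
      (integrable_mordellKernel_div_mordellDenom_line hn hs hx ha)]
  congr! 3 with u
  rw [mordellKernel_eq_mul_exp s x κ, ← sub_div,
    div_eq_iff (mordellDenom_line_ne_zero hn u), mordellDenom]
  ring

theorem mordellIntegral_natCast_sub {n : ℤ} (hn : a = n + 1 / 2) (hs : 0 ≤ s) (hx : 0 < x)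
    (ha : 0 < a) (K : ℕ) :
    mordellIntegral s x K a - mordellIntegral s x 0 a =
      rho * ∑ k ∈ Finset.range K, ∫ u : ℝ, mordellKernel s x (k + 1) (a + rho * u) := by
  simp only [Finset.mul_sum, ← mordellIntegral_sub_of_kernel hn hs hx ha]
  simpa using (Finset.sum_range_sub (fun k : ℕ => mordellIntegral s x k a) K).symm

theorem norm_mordellIntegral_le {n : ℤ} (hn : a = n + 1 / 2) (hs : 0 ≤ s) (hx : 0 < x)
    (ha : 0 < a) (κ : ℝ) :
    ‖mordellIntegral s x κ a‖ ≤ (a / 2) ^ (-s) * (Real.exp (π * (κ - x * a) ^ 2 / x) *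
      (2 * ∫ u : ℝ, Real.exp (-(π * x / 2) * u ^ 2))) := by
  simp only [mordellIntegral, ← integral_const_mul]
  refine norm_integral_le_of_norm_le ((((integrable_exp_neg_mul_sq (by positivity)).const_mul
    _).const_mul _).const_mul _) (ae_of_all _ fun u => ?_)
  have hden := half_le_norm_mordellDenom_line hn u
  have hker := norm_mordellKernel_le (κ := κ) hs hx ha (line_re_sub_im a u).ge
  rw [line_re_sub_im, line_im_sq] at hker
  rw [norm_mul, norm_rho, mul_one, norm_div, div_le_iff₀ (by linarith)]
  calc ‖mordellKernel s x κ (a + rho * u)‖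
      ≤ (a / 2) ^ (-s) * Real.exp (π * (κ - x * a) ^ 2 / x) *
        Real.exp (-(π * x) * (u ^ 2 / 2)) := hker
    _ = (a / 2) ^ (-s) * (Real.exp (π * (κ - x * a) ^ 2 / x) *
        (2 * Real.exp (-(π * x / 2) * u ^ 2))) * (1 / 2) := by ring_nf
    _ ≤ _ := by gcongr

theorem tendsto_mordellIntegral_zero (hs : 0 < s) (hx : 0 < x) {κ : ℕ → ℝ}
    (hκ : ∀ N : ℕ, |κ N - x * (N + 1 / 2)| ≤ 1) :
    Tendsto (fun N : ℕ => mordellIntegral s x (κ N) (N + 1 / 2)) atTop (𝓝 0) := by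
  have hhalf : Tendsto (fun N : ℕ => ((N : ℝ) + 1 / 2) / 2) atTop atTop :=
    (tendsto_atTop_add_const_right _ _ tendsto_natCast_atTop_atTop).atTop_div_const two_pos
  have hbound : Tendsto (fun N : ℕ => (((N : ℝ) + 1 / 2) / 2) ^ (-s) * (Real.exp (π / x) *
      (2 * ∫ u : ℝ, Real.exp (-(π * x / 2) * u ^ 2)))) atTop (𝓝 0) := by
    simpa using ((tendsto_rpow_neg_atTop hs).comp hhalf).mul_const _
  refine squeeze_zero_norm (fun N => (norm_mordellIntegral_le (n := N) (by simp) hs.le hx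
    (by positivity) _).trans ?_) hbound
  have hsq : π * (κ N - x * (N + 1 / 2)) ^ 2 / x ≤ π / x := by
    have := (sq_le_one_iff_abs_le_one _).2 (hκ N)
    gcongr
    exact mul_le_of_le_one_right Real.pi_pos.le this
  gcongr

end MordellIntegral

section FunctionalEquation

variable {s x c : ℝ}

theorem partialF_eq_sum_range (s x : ℝ) (N : ℕ) :
    partialF s x N = ∑ m ∈ Finset.range N,
      Complex.exp (Complex.I * π * ((m : ℂ) + 1) ^ 2 * x) * ((m : ℂ) + 1) ^ (-(s : ℂ)) := by
  induction N with
  | zero => simp [partialF]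
  | succ N ih =>
    rw [partialF, Finset.sum_Icc_succ_top (by lia), ← partialF, ih, Finset.sum_range_succ,
      Complex.ofReal_cpow (by positivity), Complex.cpow_neg, div_eq_mul_inv]
    push_cast
    rfl

/-- The increment `(c + ρv)^{-s} - c^{-s}` of `z^{-s}` along the line `c + ρℝ`. -/
def linePowSub (s c v : ℝ) : ℂ := ((c : ℂ) + rho * v) ^ (-(s : ℂ)) - (c : ℂ) ^ (-(s : ℂ))

theorem innerSeries_eq_tsum (s x u : ℝ) :
    innerSeries s x u = ∑' m : ℕ, Complex.exp (-(Complex.I * π * ((m : ℂ) + 1) ^ 2 / x)) *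
      linePowSub s (m + 1) (x * u) := by
  simp only [innerSeries, linePowSub, one_div, ← Complex.cpow_neg]
  push_cast
  simp only [add_comm, mul_assoc]

theorem line_mem_slitPlane (hc : 0 < c) (v : ℝ) : (c : ℂ) + rho * v ∈ Complex.slitPlane :=
  mem_slitPlane_of_im_lt_re (sub_pos.1 (by rwa [line_re_sub_im]))

theorem hasDerivAt_line_cpow_neg (s : ℝ) (hc : 0 < c) (v : ℝ) :
    HasDerivAt (fun v : ℝ => ((c : ℂ) + rho * v) ^ (-(s : ℂ)))
      (-(s : ℂ) * ((c : ℂ) + rho * v) ^ (-((s + 1 : ℝ) : ℂ)) * rho) v := by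
  have hline : HasDerivAt (fun v : ℂ => (c : ℂ) + rho * v) rho v := by
    simpa using ((hasDerivAt_id (v : ℂ)).const_mul rho).const_add (c : ℂ)
  convert (hline.cpow_const (line_mem_slitPlane hc v)).comp_ofReal using 4
  push_cast
  ring

theorem continuous_line_cpow_neg (s : ℝ) (hc : 0 < c) :
    Continuous fun v : ℝ => ((c : ℂ) + rho * v) ^ (-(s : ℂ)) :=
  continuous_iff_continuousAt.2 fun v => (hasDerivAt_line_cpow_neg s hc v).continuousAt

theorem norm_linePowSub_le (hs : 0 ≤ s) (hc : 0 < c) (v : ℝ) :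
    ‖linePowSub s c v‖ ≤ s * (c / 2) ^ (-(s + 1)) * |v| := by
  have hderiv : ∀ w ∈ univ,
      ‖-(s : ℂ) * ((c : ℂ) + rho * (w : ℝ)) ^ (-((s + 1 : ℝ) : ℂ)) * rho‖ ≤
        s * (c / 2) ^ (-(s + 1)) := fun w _ => by
    rw [norm_mul, norm_mul, norm_rho, mul_one, norm_neg, Complex.norm_real,
      Real.norm_of_nonneg hs]
    have := norm_cpow_neg_le (s := s + 1) (by linarith) hc (line_re_sub_im c w).ge
    gcongr
  simpa [linePowSub] using convex_univ.norm_image_sub_le_of_norm_hasDerivWithin_le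
    (fun w _ => (hasDerivAt_line_cpow_neg s hc w).hasDerivWithinAt) hderiv (mem_univ (0 : ℝ))
    (mem_univ v)

/-- The Gaussian weight `e^{-πxu²}`, as a complex number. -/
def gaussian (x u : ℝ) : ℂ := (Real.exp (-(π * x * u ^ 2)) : ℝ)

theorem norm_gaussian (x u : ℝ) : ‖gaussian x u‖ = Real.exp (-(π * x) * u ^ 2) := by
  rw [gaussian, Complex.norm_real, Real.norm_of_nonneg (Real.exp_pos _).le, neg_mul]

theorem continuous_gaussian (x : ℝ) : Continuous (gaussian x) := by
  unfold gaussian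
  fun_prop

theorem integrable_gaussian (hx : 0 < x) : Integrable (gaussian x) :=
  (integrable_exp_neg_mul_sq (b := π * x) (by positivity)).mono'
    (continuous_gaussian x).aestronglyMeasurable (ae_of_all _ fun u => (norm_gaussian x u).le)

theorem integral_gaussian_eq_sqrt (x : ℝ) : ∫ u : ℝ, gaussian x u = (√(1 / x) : ℝ) := by
  have := integral_gaussian (π * x)
  simp only [neg_mul, ← div_div, div_self Real.pi_ne_zero] at this
  simp only [gaussian, integral_complex_ofReal, this]

/-- The integral `∫ e^{-πxu²} ((c + ρxu)^{-s} - c^{-s}) du`, which measures the failure of the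
stationary phase approximation at `c / x` to be exact. -/
def saddleError (s x c : ℝ) : ℂ := ∫ u : ℝ, gaussian x u * linePowSub s c (x * u)

theorem norm_gaussian_mul_linePowSub_le (hs : 0 ≤ s) (hx : 0 < x) (hc : 0 < c) (u : ℝ) :
    ‖gaussian x u * linePowSub s c (x * u)‖ ≤
      s * (c / 2) ^ (-(s + 1)) * x * ‖u * Real.exp (-(π * x) * u ^ 2)‖ := by
  have := norm_linePowSub_le hs hc (x * u)
  rw [abs_mul, abs_of_pos hx] at this
  rw [norm_mul, norm_mul, norm_gaussian, Real.norm_of_nonneg (Real.exp_pos _).le,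
    Real.norm_eq_abs]
  calc Real.exp (-(π * x) * u ^ 2) * ‖linePowSub s c (x * u)‖
      ≤ Real.exp (-(π * x) * u ^ 2) * (s * (c / 2) ^ (-(s + 1)) * (x * |u|)) := by gcongr
    _ = _ := by ring

theorem integrable_mul_exp_norm (hx : 0 < x) :
    Integrable fun u : ℝ => ‖u * Real.exp (-(π * x) * u ^ 2)‖ :=
  (integrable_mul_exp_neg_mul_sq (by positivity)).norm

theorem integrable_gaussian_mul_linePowSub (hs : 0 ≤ s) (hx : 0 < x) (hc : 0 < c) :
    Integrable fun u : ℝ => gaussian x u * linePowSub s c (x * u) :=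
  ((integrable_mul_exp_norm hx).const_mul _).mono'
    ((continuous_gaussian x).mul (((continuous_line_cpow_neg s hc).comp
      (continuous_const_mul x)).sub continuous_const)).aestronglyMeasurable
    (ae_of_all _ fun u => norm_gaussian_mul_linePowSub_le hs hx hc u)

theorem integral_norm_gaussian_mul_linePowSub_le (hs : 0 ≤ s) (hx : 0 < x) (hc : 0 < c) :
    ∫ u : ℝ, ‖gaussian x u * linePowSub s c (x * u)‖ ≤
      s * (c / 2) ^ (-(s + 1)) * x * ∫ u : ℝ, ‖u * Real.exp (-(π * x) * u ^ 2)‖ := by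
  rw [← integral_const_mul]
  exact integral_mono (integrable_gaussian_mul_linePowSub hs hx hc).norm
    ((integrable_mul_exp_norm hx).const_mul _)
    fun u => norm_gaussian_mul_linePowSub_le hs hx hc u

theorem ofReal_mul_cpow (hx : 0 < x) {z : ℂ} (hz : z ≠ 0) (w : ℂ) :
    ((x : ℂ) * z) ^ w = (x : ℂ) ^ w * z ^ w := by
  have hx' : (x : ℂ) ≠ 0 := by exact_mod_cast hx.ne'
  rw [Complex.cpow_def_of_ne_zero (mul_ne_zero hx' hz), Complex.log_ofReal_mul hx hz, add_mul,
    Complex.exp_add, Complex.cpow_def_of_ne_zero hx', Complex.ofReal_log hx.le,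
    Complex.cpow_def_of_ne_zero hz]

theorem mordellKernel_saddle_line (hx : 0 < x) (hc : 0 < c) (u : ℝ) :
    mordellKernel s x c ((c / x : ℝ) + rho * u) =
      ((x ^ s : ℝ) : ℂ) * (Complex.exp (-(Complex.I * π * c ^ 2 / x)) *
        (gaussian x u * ((c : ℂ) + rho * (x * u : ℝ)) ^ (-(s : ℂ)))) := by
  have hx' : (x : ℂ) ≠ 0 := by exact_mod_cast hx.ne'
  have hz := Complex.slitPlane_ne_zero (line_mem_slitPlane (div_pos hc hx) u)
  have hscale : (c : ℂ) + rho * (x * u : ℝ) = x * ((c / x : ℝ) + rho * u) := by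
    push_cast; field_simp
  have hxs : ((x ^ s : ℝ) : ℂ) * (x : ℂ) ^ (-(s : ℂ)) = 1 := by
    rw [Complex.ofReal_cpow hx.le, ← Complex.cpow_add _ _ hx', add_neg_cancel, Complex.cpow_zero]
  have hexp : Complex.I * π * ((c / x : ℝ) + rho * u) ^ 2 * x
      - 2 * Complex.I * π * c * ((c / x : ℝ) + rho * u)
      = -(Complex.I * π * (c : ℂ) ^ 2 / x) + ((-(π * x * u ^ 2) : ℝ) : ℂ) := by
    push_cast
    field_simp
    linear_combination (Complex.I * x ^ 2 * u ^ 2) * rho_sq + x ^ 2 * u ^ 2 * Complex.I_sq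
  rw [hscale, ofReal_mul_cpow hx hz, mordellKernel, hexp, Complex.exp_add, gaussian,
    Complex.ofReal_exp]
  linear_combination (-(Complex.exp (-(Complex.I * π * (c : ℂ) ^ 2 / x)) *
    Complex.exp ((-(π * x * u ^ 2) : ℝ) : ℂ) *
    (((c / x : ℝ) : ℂ) + rho * u) ^ (-(s : ℂ)))) * hxs

theorem integral_gaussian_mul_line_cpow_neg (hs : 0 ≤ s) (hx : 0 < x) (hc : 0 < c) :
    ∫ u : ℝ, gaussian x u * ((c : ℂ) + rho * (x * u : ℝ)) ^ (-(s : ℂ)) =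
      (√(1 / x) : ℝ) * (c : ℂ) ^ (-(s : ℂ)) + saddleError s x c := by
  rw [saddleError, ← integral_gaussian_eq_sqrt, ← integral_mul_const, ← integral_add
    ((integrable_gaussian hx).mul_const _) (integrable_gaussian_mul_linePowSub hs hx hc)]
  simp only [linePowSub, ← mul_add, add_sub_cancel]

theorem integral_mordellKernel_line (hs : 0 ≤ s) (hx : 0 < x) (hc : 0 < c) {a : ℝ} (ha : 0 < a) :
    ∫ u : ℝ, mordellKernel s x c (a + rho * u) =
      ((x ^ s : ℝ) : ℂ) * (Complex.exp (-(Complex.I * π * c ^ 2 / x)) *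
        ((√(1 / x) : ℝ) * (c : ℂ) ^ (-(s : ℂ)) + saddleError s x c)) := by
  rw [integral_mordellKernel_line_eq hs hx ha (div_pos hc hx),
    ← integral_gaussian_mul_line_cpow_neg hs hx hc, ← integral_const_mul, ← integral_const_mul]
  simp only [mordellKernel_saddle_line hx hc]

theorem norm_exp_neg_I_mul_natCast_succ_sq (x : ℝ) (m : ℕ) :
    ‖Complex.exp (-(Complex.I * π * ((m : ℂ) + 1) ^ 2 / x))‖ = 1 := by
  rw [show -(Complex.I * π * ((m : ℂ) + 1) ^ 2 / x) =
    ((-(π * ((m : ℝ) + 1) ^ 2 / x) : ℝ) : ℂ) * Complex.I by push_cast; ring,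
    Complex.norm_exp_ofReal_mul_I]

theorem hasSum_saddleError (hs : 0 < s) (hx : 0 < x) :
    HasSum (fun m : ℕ => Complex.exp (-(Complex.I * π * ((m : ℂ) + 1) ^ 2 / x)) *
      saddleError s x (m + 1)) (∫ u : ℝ, gaussian x u * innerSeries s x u) := by
  set f : ℕ → ℝ → ℂ := fun m u => Complex.exp (-(Complex.I * π * ((m : ℂ) + 1) ^ 2 / x)) *
    (gaussian x u * linePowSub s (m + 1) (x * u)) with hf
  have hint : ∀ m, Integrable (f m) := fun m =>
    (integrable_gaussian_mul_linePowSub hs.le hx m.cast_add_one_pos).const_mul _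
  have hpow : Summable fun m : ℕ => (((m : ℝ) + 1) / 2) ^ (-(s + 1)) := by
    have := (summable_nat_add_iff 1).2
      ((Real.summable_nat_rpow (p := -(s + 1))).2 (by linarith))
    simp only [Nat.cast_add, Nat.cast_one] at this
    refine (this.div_const (2 ^ (-(s + 1)))).congr fun m => ?_
    rw [Real.div_rpow (by positivity) two_pos.le]
  have hsum : Summable fun m : ℕ => ∫ u : ℝ, ‖f m u‖ := by
    refine Summable.of_nonneg_of_le (fun m => integral_nonneg fun u => norm_nonneg _) (fun m => ?_)
      (((hpow.mul_left s).mul_right x).mul_right (∫ u : ℝ, ‖u * Real.exp (-(π * x) * u ^ 2)‖))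
    simp only [hf, norm_mul (Complex.exp _), norm_exp_neg_I_mul_natCast_succ_sq, one_mul]
    exact integral_norm_gaussian_mul_linePowSub_le hs.le hx m.cast_add_one_pos
  have hinner : ∀ u, gaussian x u * innerSeries s x u = ∑' m : ℕ, f m u := fun u => by
    simp only [innerSeries_eq_tsum, hf, ← tsum_mul_left, mul_left_comm]
  simpa only [hinner, hf, integral_const_mul, saddleError] using
    hasSum_integral_of_summable_integral_norm hint hsum

theorem partialF_eq_mordellIntegral_sub (hs : 0 ≤ s) (hx : 0 < x) (N : ℕ) :
    partialF s x N = mordellIntegral s x 0 (1 / 2) - mordellIntegral s x 0 (N + 1 / 2) := by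
  have htel := Finset.sum_range_sub' (fun n : ℕ => mordellIntegral s x 0 (n + 1 / 2)) N
  simp only [mordellIntegral_sub_of_residue hs hx] at htel
  simpa [partialF_eq_sum_range, mordellKernel] using htel

theorem sum_exp_mul_sqrt_mul_cpow_neg (hx : 0 < x) (K : ℕ) :
    ((x ^ s : ℝ) : ℂ) * ∑ m ∈ Finset.range K,
      Complex.exp (-(Complex.I * π * ((m : ℂ) + 1) ^ 2 / x)) *
        ((√(1 / x) : ℝ) * ((m : ℂ) + 1) ^ (-(s : ℂ))) =
      ((x ^ (s - 1 / 2) : ℝ) : ℂ) * partialF s (-1 / x) K := by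
  have hpow : ((x ^ (s - 1 / 2) : ℝ) : ℂ) = ((x ^ s : ℝ) : ℂ) * (√(1 / x) : ℝ) := by
    rw [← Complex.ofReal_mul, Real.rpow_sub hx, Real.sqrt_div zero_le_one, Real.sqrt_one,
      Real.sqrt_eq_rpow, mul_one_div]
  have hphase : ∀ m : ℕ, Complex.I * π * ((m : ℂ) + 1) ^ 2 * ((-1 / x : ℝ) : ℂ) =
      -(Complex.I * π * ((m : ℂ) + 1) ^ 2 / x) := fun m => by push_cast; ring
  simp only [hpow, partialF_eq_sum_range, hphase]
  simp only [mul_assoc, Finset.mul_sum, mul_left_comm]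

theorem partialF_eq_lineIntegral_add (hs : 0 < s) (hx : 0 < x) (N K : ℕ) :
    partialF s x N = lineIntegral s x +
      rho * (((x ^ (s - 1 / 2) : ℝ) : ℂ) * partialF s (-1 / x) K +
        ((x ^ s : ℝ) : ℂ) * ∑ m ∈ Finset.range K,
          Complex.exp (-(Complex.I * π * ((m : ℂ) + 1) ^ 2 / x)) * saddleError s x (m + 1)) -
      mordellIntegral s x K (N + 1 / 2) := by
  have hshift := mordellIntegral_natCast_sub (a := (N : ℝ) + 1 / 2) (n := N) (by simp) hs.le hx
    (by positivity) K
  simp only [integral_mordellKernel_line hs.le hx (Nat.cast_add_one_pos _)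
    (show (0 : ℝ) < N + 1 / 2 by positivity)] at hshift
  push_cast at hshift
  rw [partialF_eq_mordellIntegral_sub hs.le hx, lineIntegral_eq_mordellIntegral,
    ← sum_exp_mul_sqrt_mul_cpow_neg hx, ← mul_add, ← Finset.sum_add_distrib]
  simp only [← mul_add]
  rw [Finset.mul_sum]
  linear_combination hshift

theorem tendsto_partialF_of_pos (hs : 0 < s) (hx : 0 < x) {F : ℂ}
    (hF : Tendsto (fun N => partialF s (-1 / x) N) atTop (𝓝 F)) :
    Tendsto (fun N => partialF s x N) atTop
      (𝓝 (rho * ((x ^ (s - 1 / 2) : ℝ) : ℂ) * F + Ipos s x)) := by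
  have hfloor : Tendsto (fun N : ℕ => ⌊x * (N + 1 / 2)⌋₊) atTop atTop :=
    tendsto_nat_floor_atTop.comp
      ((tendsto_atTop_add_const_right _ _ tendsto_natCast_atTop_atTop).const_mul_atTop hx)
  have hremainder := tendsto_mordellIntegral_zero (κ := fun N => ⌊x * (N + 1 / 2)⌋₊) hs hx
    fun N => abs_le.2 ⟨by linarith [Nat.lt_floor_add_one (x * ((N : ℝ) + 1 / 2))], by
      linarith [Nat.floor_le (a := x * ((N : ℝ) + 1 / 2)) (by positivity)]⟩
  have hlim := (((hF.comp hfloor).const_mul ((x ^ (s - 1 / 2) : ℝ) : ℂ)).add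
    (((hasSum_saddleError hs hx).tendsto_sum_nat.comp hfloor).const_mul
      ((x ^ s : ℝ) : ℂ))).const_mul rho |>.const_add (lineIntegral s x) |>.sub hremainder
  refine (hlim.congr fun N => (partialF_eq_lineIntegral_add hs hx N _).symm).trans (le_of_eq ?_)
  simp only [Ipos, gaussian]
  congr 1
  ring

theorem conj_partialF (s x : ℝ) (N : ℕ) :
    (starRingEnd ℂ) (partialF s x N) = partialF s (-x) N := by
  rw [partialF, partialF, map_sum]
  refine Finset.sum_congr rfl fun k _ => ?_
  rw [map_div₀, ← Complex.exp_conj, Complex.conj_ofReal]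
  simp

theorem tendsto_partialF_neg {F : ℂ} (hF : Tendsto (fun N => partialF s x N) atTop (𝓝 F)) :
    Tendsto (fun N => partialF s (-x) N) atTop (𝓝 ((starRingEnd ℂ) F)) := by
  simpa only [Function.comp_def, conj_partialF] using (Complex.continuous_conj.tendsto F).comp hF

theorem tendsto_partialF (hs : 0 < s) (hx : x ≠ 0) {F : ℂ}
    (hF : Tendsto (fun N => partialF s (-1 / x) N) atTop (𝓝 F)) :
    Tendsto (fun N => partialF s x N) atTop
      (𝓝 (Complex.exp (Complex.I * (π / 4) * (Real.sign x : ℝ)) *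
        ((|x| ^ (s - 1 / 2) : ℝ) : ℂ) * F + Omega s x)) := by
  rcases hx.lt_or_gt with hneg | hpos
  · have hconj := tendsto_partialF_neg hF
    rw [show -(-1 / x) = -1 / -x by ring] at hconj
    have hlim := tendsto_partialF_neg (tendsto_partialF_of_pos hs (neg_pos.2 hneg) hconj)
    rw [neg_neg] at hlim
    convert hlim using 2
    rw [Omega, if_neg hneg.le.not_gt, abs_of_neg hneg, Real.sign_of_neg hneg, rho, map_add,
      map_mul, map_mul, Complex.conj_conj, Complex.conj_ofReal, ← Complex.exp_conj]
    simp [Complex.conj_ofNat]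
  · rw [Omega, if_pos hpos, abs_of_pos hpos, Real.sign_of_pos hpos]
    simpa [rho] using tendsto_partialF_of_pos hs hpos hF

theorem partialF_add_two_mul_intCast (s x : ℝ) (n : ℤ) (N : ℕ) :
    partialF s (x + 2 * n) N = partialF s x N := by
  rw [partialF, partialF]
  refine Finset.sum_congr rfl fun k _ => ?_
  have hexp : Complex.I * π * (k : ℂ) ^ 2 * ((x + 2 * n : ℝ) : ℂ) =
      Complex.I * π * (k : ℂ) ^ 2 * x + 2 * Complex.I * π * ((k ^ 2 * n : ℤ) : ℂ) := by
    push_cast; ring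
  rw [hexp, Complex.exp_add, exp_two_pi_I_mul_intCast, mul_one]

theorem partialF_T (s x : ℝ) (N : ℕ) : partialF s (T x) N = partialF s (-1 / x) N := by
  rw [← partialF_add_two_mul_intCast s (T x) ⌊(-1 / x + 1) / 2⌋, T, sub_add_cancel]

end FunctionalEquation

section WeylSums

variable {N y : ℝ}

/-- The distance of `t` to the nearest integer. -/
def distInt (t : ℝ) : ℝ := |t - round t|

theorem distInt_le (t : ℝ) (n : ℤ) : distInt t ≤ |t - n| := round_le t n

theorem distInt_le_half (t : ℝ) : distInt t ≤ 1 / 2 := abs_sub_round t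

theorem distInt_nonneg (t : ℝ) : 0 ≤ distInt t := abs_nonneg _

theorem distInt_sub_le_of_mul_nonneg {t u : ℝ} (h : 0 ≤ (t - round t) * (u - round u)) :
    distInt (t - u) ≤ |distInt t - distInt u| := by
  have hdist : distInt (t - u) ≤ |(t - round t) - (u - round u)| := by
    refine (distInt_le (t - u) (round t - round u)).trans_eq (congrArg _ ?_)
    push_cast
    ring
  refine hdist.trans_eq ?_
  rcases mul_nonneg_iff.1 h with ⟨ht, hu⟩ | ⟨ht, hu⟩
  · rw [distInt, distInt, abs_of_nonneg ht, abs_of_nonneg hu]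
  · rw [distInt, distInt, abs_of_nonpos ht, abs_of_nonpos hu, ← abs_neg]
    ring_nf

theorem two_mul_distInt_le_abs_sin (t : ℝ) : 2 * distInt t ≤ |Real.sin (π * t)| := by
  have hperiod : |Real.sin (π * t)| = |Real.sin (π * (t - round t))| := by
    rw [mul_sub, mul_comm π (round t : ℝ), Real.sin_sub_int_mul_pi, abs_mul, abs_neg_one_zpow,
      one_mul]
  have habs : |π * (t - round t)| = π * distInt t := by
    rw [abs_mul, abs_of_pos Real.pi_pos, distInt]
  have hjordan := Real.mul_abs_le_abs_sin (x := π * (t - round t))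
    (by nlinarith [Real.pi_pos, distInt_le_half t])
  rwa [habs, ← mul_assoc, div_mul_cancel₀ _ Real.pi_ne_zero, ← hperiod] at hjordan

theorem four_mul_distInt_le_norm_exp_sub_one (t : ℝ) :
    4 * distInt t ≤ ‖Complex.exp ((2 * π * t : ℝ) * Complex.I) - 1‖ := by
  rw [mul_comm _ Complex.I, Complex.norm_exp_I_mul_ofReal_sub_one, norm_mul, Real.norm_two,
    Real.norm_eq_abs, mul_assoc, mul_div_cancel_left₀ _ two_ne_zero]
  linarith [two_mul_distInt_le_abs_sin t]

/-- `min(N, 1 / (2‖t‖))` with `‖t‖` the distance to the nearest integer. The form `(max ..)⁻¹`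
gives the value `N`, and not the junk value `0`, when `‖t‖ = 0`. -/
def cappedInv (N t : ℝ) : ℝ := (max (1 / N) (2 * distInt t))⁻¹

theorem cappedInv_nonneg (hN : 0 < N) (t : ℝ) : 0 ≤ cappedInv N t :=
  inv_nonneg.2 (le_max_of_le_left (by positivity))

theorem cappedInv_le (hN : 0 < N) (t : ℝ) : cappedInv N t ≤ N :=
  (inv_anti₀ (by positivity) (le_max_left _ _)).trans_eq (by simp)

theorem cappedInv_le_inv {d t : ℝ} (hd : 0 < d) (hdt : d ≤ 2 * distInt t) :
    cappedInv N t ≤ d⁻¹ :=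
  inv_anti₀ hd (hdt.trans (le_max_right _ _))

theorem norm_geom_sum_exp_le (hN : 0 < N) (t : ℝ) {L : ℕ} (hL : (L : ℝ) ≤ N) :
    ‖∑ l ∈ Finset.range L, Complex.exp ((2 * π * t : ℝ) * Complex.I) ^ l‖ ≤ cappedInv N t := by
  set w := Complex.exp ((2 * π * t : ℝ) * Complex.I)
  set G := ‖∑ l ∈ Finset.range L, w ^ l‖ with hG
  have hw : ‖w‖ = 1 := Complex.norm_exp_ofReal_mul_I _
  have htrivial : G ≤ N := (norm_sum_le _ _).trans (by simpa [hw] using hL)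
  have hgeom : ‖w - 1‖ * G ≤ 2 := by
    rw [hG, ← norm_mul, mul_geom_sum]
    refine (norm_sub_le _ _).trans ?_
    rw [norm_pow, hw, one_pow, norm_one, one_add_one_eq_two]
  have hdist := mul_le_mul_of_nonneg_right (four_mul_distInt_le_norm_exp_sub_one t)
    (norm_nonneg _ : 0 ≤ G)
  rw [cappedInv, ← one_div, le_div_iff₀ (lt_max_of_lt_left (by positivity)),
    mul_max_of_nonneg _ _ (norm_nonneg _)]
  refine max_le ?_ (by linarith)
  rwa [mul_one_div, div_le_one hN]

theorem norm_sum_range_sq_eq (b : ℕ → ℂ) (N : ℕ) :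
    ‖∑ k ∈ Finset.range N, b k‖ ^ 2 = ∑ k ∈ Finset.range N, ‖b k‖ ^ 2 +
      2 * (∑ h ∈ Finset.range N, ∑ l ∈ Finset.range (N - 1 - h),
        b (l + (h + 1)) * (starRingEnd ℂ) (b l)).re := by
  induction N with
  | zero => simp
  | succ N ih =>
    have hcorr : ∑ h ∈ Finset.range (N + 1), ∑ l ∈ Finset.range (N + 1 - 1 - h),
        b (l + (h + 1)) * (starRingEnd ℂ) (b l) =
        ∑ h ∈ Finset.range N, ∑ l ∈ Finset.range (N - 1 - h),
          b (l + (h + 1)) * (starRingEnd ℂ) (b l) +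
        b N * (starRingEnd ℂ) (∑ k ∈ Finset.range N, b k) := by
      rw [Finset.sum_range_succ, show N + 1 - 1 - N = 0 by lia, Finset.sum_range_zero, add_zero,
        map_sum, Finset.mul_sum, ← Finset.sum_range_reflect (fun k => b N * (starRingEnd ℂ) (b k)),
        ← Finset.sum_add_distrib]
      refine Finset.sum_congr rfl fun h hh => ?_
      rw [Finset.mem_range] at hh
      rw [show N + 1 - 1 - h = (N - 1 - h) + 1 by lia, Finset.sum_range_succ,
        show N - 1 - h + (h + 1) = N by lia]
    rw [hcorr, Finset.sum_range_succ, Finset.sum_range_succ, Complex.add_re, mul_add,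
      add_comm (∑ k ∈ Finset.range N, b k), ← Complex.normSq_eq_norm_sq, Complex.normSq_add,
      Complex.normSq_eq_norm_sq, Complex.normSq_eq_norm_sq, ih]
    ring

/-- The exponential sum `∑_{k=1}^N e^{iπk²y}`. -/
def weylSum (y : ℝ) (N : ℕ) : ℂ :=
  ∑ k ∈ Finset.range N, Complex.exp ((π * ((k : ℝ) + 1) ^ 2 * y : ℝ) * Complex.I)

theorem norm_weylSum_le (y : ℝ) (N : ℕ) : ‖weylSum y N‖ ≤ N :=
  (norm_sum_le _ _).trans (by simp only [Complex.norm_exp_ofReal_mul_I]; simp)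

-- Differencing turns the quadratic phase into a linear one, so the inner sums are geometric.
theorem norm_weylSum_sq_le (y : ℝ) {N : ℕ} (hN : 0 < N) :
    ‖weylSum y N‖ ^ 2 ≤ N + 2 * ∑ h ∈ Finset.range N, cappedInv N (((h : ℝ) + 1) * y) := by
  rw [weylSum, norm_sum_range_sq_eq]
  refine add_le_add (by simp only [Complex.norm_exp_ofReal_mul_I]; simp)
    (mul_le_mul_of_nonneg_left ?_ two_pos.le)
  refine (Complex.re_le_norm _).trans ((norm_sum_le _ _).trans (Finset.sum_le_sum fun h _ => ?_))
  have hlinear : ∀ l : ℕ,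
      Complex.exp ((π * (((l + (h + 1) : ℕ) : ℝ) + 1) ^ 2 * y : ℝ) * Complex.I) *
        (starRingEnd ℂ) (Complex.exp ((π * ((l : ℝ) + 1) ^ 2 * y : ℝ) * Complex.I)) =
      Complex.exp ((π * (((h : ℝ) + 1) ^ 2 + 2 * (h + 1)) * y : ℝ) * Complex.I) *
        Complex.exp ((2 * π * (((h : ℝ) + 1) * y) : ℝ) * Complex.I) ^ l := fun l => by
    rw [← Complex.exp_conj, map_mul, Complex.conj_ofReal, Complex.conj_I, ← Complex.exp_nat_mul,
      ← Complex.exp_add, ← Complex.exp_add]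
    push_cast
    ring_nf
  simp only [hlinear, ← Finset.mul_sum, norm_mul, Complex.norm_exp_ofReal_mul_I, one_mul]
  exact norm_geom_sum_exp_le (by exact_mod_cast hN) _ (by exact_mod_cast (by lia))

section SpacedPoints

variable {ι : Type*} {q : ℕ} {S : Finset ι} {z : ι → ℝ}

theorem injOn_floor_distInt (hq : 0 < q)
    (hsign : ∀ i ∈ S, ∀ j ∈ S, 0 ≤ (z i - round (z i)) * (z j - round (z j)))
    (hspaced : (S : Set ι).Pairwise fun i j => 1 / (2 * (q : ℝ)) ≤ distInt (z i - z j)) :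
    InjOn (fun i => ⌊2 * q * distInt (z i)⌋₊) S := fun i hi j hj hij => by
  by_contra hne
  have hgap := (hspaced hi hj hne).trans (distInt_sub_le_of_mul_nonneg (hsign i hi j hj))
  have hq' : (0 : ℝ) < 2 * q := by positivity
  have hfloor : ∀ k, (⌊2 * q * distInt (z k)⌋₊ : ℤ) = ⌊2 * q * distInt (z k)⌋ := fun k =>
    Int.natCast_floor_eq_floor (mul_nonneg hq'.le (distInt_nonneg _))
  have hclose := Int.abs_sub_lt_one_of_floor_eq_floor
    ((hfloor i).symm.trans ((congrArg Nat.cast hij).trans (hfloor j)))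
  rw [← mul_sub, abs_mul, abs_of_pos hq', mul_comm, ← lt_div_iff₀ hq'] at hclose
  exact absurd hgap hclose.not_ge

theorem sum_range_ite_div_le (N : ℝ) (q : ℕ) :
    ∑ j ∈ Finset.range (q + 1), (if j = 0 then N else (q : ℝ) / j) ≤ N + q * (1 + Real.log q) := by
  have hharmonic : ∑ j ∈ Finset.range q, ((j : ℝ) + 1)⁻¹ ≤ 1 + Real.log q := by
    simpa [harmonic] using harmonic_le_one_add_log q
  rw [Finset.sum_range_succ', add_comm]
  simpa [div_eq_mul_inv, ← Finset.mul_sum] using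
    mul_le_mul_of_nonneg_left hharmonic q.cast_nonneg

theorem cappedInv_le_ite_floor (hN : 0 < N) (hq : 0 < q) (t : ℝ) :
    cappedInv N t ≤
      if ⌊2 * q * distInt t⌋₊ = 0 then N else (q : ℝ) / ⌊2 * q * distInt t⌋₊ := by
  split_ifs with hfloor
  · exact cappedInv_le hN t
  · have hle := Nat.floor_le (mul_nonneg (by positivity : (0 : ℝ) ≤ 2 * q) (distInt_nonneg t))
    have : (0 : ℝ) < ⌊2 * q * distInt t⌋₊ := by exact_mod_cast Nat.pos_of_ne_zero hfloor
    rw [← inv_div]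
    refine cappedInv_le_inv (by positivity) ?_
    rw [div_le_iff₀ (by positivity)]
    linarith

-- Spaced points with residues of one sign fall into different bins of width `1 / (2q)`.
theorem sum_cappedInv_le_of_mul_nonneg (hN : 0 < N) (hq : 0 < q)
    (hsign : ∀ i ∈ S, ∀ j ∈ S, 0 ≤ (z i - round (z i)) * (z j - round (z j)))
    (hspaced : (S : Set ι).Pairwise fun i j => 1 / (2 * (q : ℝ)) ≤ distInt (z i - z j)) :
    ∑ i ∈ S, cappedInv N (z i) ≤ N + q * (1 + Real.log q) := by
  set bin : ι → ℕ := fun i => ⌊2 * q * distInt (z i)⌋₊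
  have hrange : S.image bin ⊆ Finset.range (q + 1) := Finset.image_subset_iff.2 fun i _ => by
    rw [Finset.mem_range, Nat.lt_add_one_iff]
    exact Nat.floor_le_of_le (by nlinarith [distInt_le_half (z i), q.cast_nonneg (α := ℝ)])
  calc ∑ i ∈ S, cappedInv N (z i)
      ≤ ∑ i ∈ S, if bin i = 0 then N else (q : ℝ) / bin i :=
        Finset.sum_le_sum fun i _ => cappedInv_le_ite_floor hN hq (z i)
    _ = ∑ j ∈ S.image bin, if j = 0 then N else (q : ℝ) / j :=
        (Finset.sum_image (f := fun j : ℕ => if j = 0 then N else (q : ℝ) / j)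
          (injOn_floor_distInt hq hsign hspaced)).symm
    _ ≤ ∑ j ∈ Finset.range (q + 1), if j = 0 then N else (q : ℝ) / j :=
        Finset.sum_le_sum_of_subset_of_nonneg hrange fun j _ _ => by split_ifs <;> positivity
    _ ≤ N + q * (1 + Real.log q) := sum_range_ite_div_le N q

theorem sum_cappedInv_le (hN : 0 < N) (hq : 0 < q)
    (hspaced : (S : Set ι).Pairwise fun i j => 1 / (2 * (q : ℝ)) ≤ distInt (z i - z j)) :
    ∑ i ∈ S, cappedInv N (z i) ≤ 2 * (N + q * (1 + Real.log q)) := by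
  classical
  rw [← Finset.sum_filter_add_sum_filter_not S fun i => 0 ≤ z i - round (z i), two_mul]
  have hmono (p : ι → Prop) [DecidablePred p] : ((S.filter p : Finset ι) : Set ι) ⊆ S :=
    Finset.coe_subset.2 (Finset.filter_subset _ _)
  refine add_le_add
    (sum_cappedInv_le_of_mul_nonneg hN hq (fun i hi j hj => ?_) (hspaced.mono (hmono _)))
    (sum_cappedInv_le_of_mul_nonneg hN hq (fun i hi j hj => ?_) (hspaced.mono (hmono _)))
  · exact mul_nonneg (Finset.mem_filter.1 hi).2 (Finset.mem_filter.1 hj).2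
  · exact mul_nonneg_of_nonpos_of_nonpos (not_le.1 (Finset.mem_filter.1 hi).2).le
      (not_le.1 (Finset.mem_filter.1 hj).2).le

theorem sum_range_mul_cappedInv_le {z : ℕ → ℝ} {m : ℕ} (hN : 0 < N) (hq : 0 < q)
    (hspaced : ∀ i j : ℕ, i ≠ j → |(i : ℤ) - j| < m → 1 / (2 * (q : ℝ)) ≤ distInt (z i - z j))
    (B : ℕ) :
    ∑ h ∈ Finset.range (m * B), cappedInv N (z h) ≤ B * (2 * (N + q * (1 + Real.log q))) := by
  induction B with
  | zero => simp
  | succ B ih =>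
    have hblock := sum_cappedInv_le (S := Finset.range m) (z := fun i => z (m * B + i)) hN hq
      fun i hi j hj hij => hspaced _ _ (by lia) (by
        simp only [Finset.coe_range, mem_Iio] at hi hj
        rw [abs_lt]
        lia)
    rw [Nat.mul_succ, Finset.sum_range_add]
    push_cast
    linarith

end SpacedPoints

theorem one_le_abs_intCast_mul_num_sub {r : ℚ} {i : ℤ} (hi : i ≠ 0) (hir : |i| < r.den) (n : ℤ) :
    (1 : ℝ) ≤ |(i : ℝ) * r.num - n * r.den| := by
  have hne : i * r.num - n * r.den ≠ 0 := fun h => by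
    have hdvd : (r.den : ℤ) ∣ i * r.num := ⟨n, by linarith⟩
    have hle := Int.le_of_dvd (abs_pos.2 hi)
      ((dvd_abs _ _).2 (r.isCoprime_num_den.symm.dvd_of_dvd_mul_right hdvd))
    lia
  exact_mod_cast Int.one_le_abs hne

theorem half_inv_den_le_distInt_mul {N : ℕ} {r : ℚ}
    (hr : |y - r| ≤ 1 / ((2 * N + 1) * r.den)) {i : ℤ} (hi : i ≠ 0) (hir : |i| < r.den)
    (hiN : |i| ≤ N) : 1 / (2 * (r.den : ℝ)) ≤ distInt (i * y) := by
  have hden : (0 : ℝ) < r.den := by exact_mod_cast r.den_pos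
  set n := round ((i : ℝ) * y) with hn
  have hdecomp : (i : ℝ) * r.num - n * r.den = r.den * ((i * y - n) - i * (y - r)) := by
    rw [show (r.num : ℝ) = r * r.den by exact_mod_cast (Rat.mul_den_eq_num r).symm]
    ring
  have herror : |(i : ℝ) * (y - r)| ≤ 1 / (2 * r.den) := by
    have hiN' : |(i : ℝ)| ≤ N := by exact_mod_cast hiN
    calc |(i : ℝ) * (y - r)| = |(i : ℝ)| * |y - r| := abs_mul _ _
      _ ≤ N * (1 / ((2 * N + 1) * r.den)) := by gcongr
      _ ≤ 1 / (2 * r.den) := by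
        rw [mul_one_div, div_le_div_iff₀ (by positivity) (by positivity)]
        nlinarith
  have hlower := one_le_abs_intCast_mul_num_sub hi hir n
  rw [hdecomp, abs_mul, abs_of_pos hden, ← div_le_iff₀' hden] at hlower
  have htriangle := abs_sub (i * y - n) ((i : ℝ) * (y - r))
  have hhalves : 1 / (r.den : ℝ) = 1 / (2 * r.den) + 1 / (2 * r.den) := by field_simp; norm_num
  rw [distInt, ← hn]
  linarith

theorem natCast_div_min_add_one_le {N q : ℕ} (hN : 0 < N) (hq : 0 < q) (hqN : q ≤ 2 * N) :
    ((N / min q N + 1 : ℕ) : ℝ) ≤ 4 * N / q := by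
  have hm : (0 : ℝ) < (min q N : ℕ) := by exact_mod_cast lt_min hq hN
  have hqN' : (q : ℝ) ≤ 2 * N := by exact_mod_cast hqN
  have hone : (1 : ℝ) ≤ N / (min q N : ℕ) :=
    (one_le_div hm).2 (by exact_mod_cast min_le_right q N)
  have hhalf : (q : ℝ) / 2 ≤ (min q N : ℕ) := by
    rw [Nat.cast_min]
    exact le_min (by linarith) (by linarith)
  calc ((N / min q N + 1 : ℕ) : ℝ) = (N / min q N : ℕ) + 1 := by push_cast; rfl
    _ ≤ N / (min q N : ℕ) + N / (min q N : ℕ) := add_le_add Nat.cast_div_le hone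
    _ ≤ N / (q / 2) + N / (q / 2) := by gcongr
    _ = 4 * N / q := by field_simp; norm_num

theorem sum_cappedInv_mul_le {N : ℕ} (hN : 0 < N) {r : ℚ}
    (hr : |y - r| ≤ 1 / ((2 * N + 1) * r.den)) (hrN : r.den ≤ 2 * N) :
    ∑ h ∈ Finset.range N, cappedInv N (((h : ℝ) + 1) * y) ≤
      8 * ((N : ℝ) ^ 2 / r.den + N * (1 + Real.log r.den)) := by
  have hN' : (0 : ℝ) < N := by exact_mod_cast hN
  have hden : (1 : ℝ) ≤ r.den := by exact_mod_cast r.den_pos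
  have := Real.log_nonneg hden
  set m := min r.den N
  have hblocks := sum_range_mul_cappedInv_le (z := fun h => ((h : ℝ) + 1) * y) (m := m) hN'
    r.den_pos (fun i j hij hijm => by
      rw [show ((i : ℝ) + 1) * y - ((j : ℝ) + 1) * y = ((i - j : ℤ) : ℝ) * y by push_cast; ring]
      exact half_inv_den_le_distInt_mul hr (by lia) (by lia) (by lia)) (N / m + 1)
  calc ∑ h ∈ Finset.range N, cappedInv N (((h : ℝ) + 1) * y)
      ≤ ∑ h ∈ Finset.range (m * (N / m + 1)), cappedInv N (((h : ℝ) + 1) * y) :=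
        Finset.sum_le_sum_of_subset_of_nonneg
          (Finset.range_subset_range.2 (Nat.lt_mul_div_succ N (lt_min r.den_pos hN)).le)
          fun h _ _ => cappedInv_nonneg hN' _
    _ ≤ (N / m + 1 : ℕ) * (2 * (N + r.den * (1 + Real.log r.den))) := hblocks
    _ ≤ 4 * N / r.den * (2 * (N + r.den * (1 + Real.log r.den))) := by
        gcongr
        exact natCast_div_min_add_one_le hN r.den_pos hrN
    _ = 8 * ((N : ℝ) ^ 2 / r.den + N * (1 + Real.log r.den)) := by field_simp; norm_num

theorem norm_weylSum_sq_le_of_approx {N : ℕ} (hN : 0 < N) {r : ℚ}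
    (hr : |y - r| ≤ 1 / ((2 * N + 1) * r.den)) (hrN : r.den ≤ 2 * N) :
    ‖weylSum y N‖ ^ 2 ≤ 33 * ((N : ℝ) ^ 2 / r.den + N * (1 + Real.log N)) := by
  have hN' : (1 : ℝ) ≤ N := by exact_mod_cast hN
  have hlog : Real.log r.den ≤ 1 + Real.log N := by
    have hle : Real.log r.den ≤ Real.log (2 * N) :=
      Real.log_le_log (by exact_mod_cast r.den_pos) (by exact_mod_cast hrN)
    rw [Real.log_mul two_ne_zero (by positivity)] at hle
    linarith [Real.log_two_lt_d9]
  have hmul : (N : ℝ) * Real.log r.den ≤ N * (1 + Real.log N) := by gcongr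
  have hlogN : 0 ≤ (N : ℝ) * Real.log N := mul_nonneg N.cast_nonneg (Real.log_nonneg hN')
  have hsq : 0 ≤ (N : ℝ) ^ 2 / r.den := by positivity
  linarith [norm_weylSum_sq_le y hN, sum_cappedInv_mul_le hN hr hrN]

end WeylSums

section Orbits

variable {x y M : ℝ} {a b c d : ℤ}

/-- The least denominator `q ≥ 1` such that `q x` is within `1 / M` of an integer. It has the junk
value `0` for `M < 0`. -/
def minDen (x M : ℝ) : ℕ := sInf {q : ℕ | 1 ≤ q ∧ distInt (q * x) ≤ 1 / M}

theorem minDen_spec (x : ℝ) (hM : 0 < M) :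
    1 ≤ minDen x M ∧ distInt (minDen x M * x) ≤ 1 / M := by
  refine Nat.sInf_mem (s := {q : ℕ | 1 ≤ q ∧ distInt (q * x) ≤ 1 / M}) ?_
  obtain ⟨q, hq, -, hqx⟩ := Real.exists_nat_abs_mul_sub_round_le x (Nat.ceil_pos.2 hM)
  refine ⟨q, hq, hqx.trans (one_div_le_one_div_of_le hM ?_)⟩
  linarith [Nat.le_ceil M]

theorem one_le_minDen (x : ℝ) (hM : 0 < M) : 1 ≤ minDen x M := (minDen_spec x hM).1

theorem minDen_le {q : ℕ} (hq : 1 ≤ q) (h : distInt (q * x) ≤ 1 / M) : minDen x M ≤ q :=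
  Nat.sInf_le ⟨hq, h⟩

theorem minDen_le_abs {q p : ℤ} (hq : q ≠ 0) (h : |q * x - p| ≤ 1 / M) :
    (minDen x M : ℝ) ≤ |(q : ℝ)| := by
  rw [← Int.cast_abs, Int.abs_eq_natAbs, Int.cast_natCast, Nat.cast_le]
  refine minDen_le (Int.natAbs_pos.2 hq) ?_
  rw [Nat.cast_natAbs, Int.cast_abs]
  rcases abs_choice (q : ℝ) with habs | habs <;> rw [habs]
  · exact (distInt_le _ p).trans h
  · refine (distInt_le _ (-p)).trans (le_of_eq_of_le ?_ h)
    rw [← abs_neg]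
    push_cast
    ring_nf

theorem minDen_mono (x : ℝ) {M' : ℝ} (hM : 0 < M) (h : M ≤ M') : minDen x M ≤ minDen x M' :=
  have hspec := minDen_spec x (hM.trans_le h)
  minDen_le hspec.1 (hspec.2.trans (one_div_le_one_div_of_le hM h))

theorem distInt_natCast_mul_pos (hx : Irrational x) {q : ℕ} (hq : 1 ≤ q) :
    0 < distInt (q * x) :=
  abs_pos.2 (sub_ne_zero.2 ((hx.natCast_mul (by lia)).ne_int _))

theorem tendsto_minDen_atTop (hx : Irrational x) : Tendsto (minDen x) atTop atTop := by
  refine tendsto_atTop.2 fun B => ?_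
  have hlarge : ∀ᶠ M : ℝ in atTop, ∀ q ∈ Finset.Ico 1 B, 1 / M < distInt (q * x) := by
    simp only [Filter.eventually_all_finset, one_div]
    exact fun q hq => tendsto_inv_atTop_zero.eventually_lt_const
      (distInt_natCast_mul_pos hx (Finset.mem_Ico.1 hq).1)
  filter_upwards [hlarge, eventually_gt_atTop 0] with M hM hM0
  by_contra! hlt
  obtain ⟨hone, hdist⟩ := minDen_spec x hM0
  exact (hM _ (Finset.mem_Ico.2 ⟨hone, hlt⟩)).not_ge hdist

theorem irrational_T (hy : Irrational y) : Irrational (T y) := by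
  have hinv : Irrational (-1 / y) := by
    rw [neg_div, one_div]
    exact hy.inv.neg
  simpa [T] using hinv.sub_intCast (2 * ⌊(-1 / y + 1) / 2⌋)

theorem abs_T_lt_one (hy : Irrational y) : |T y| < 1 := by
  have hfloor := Int.floor_le ((-1 / y + 1) / 2)
  have hlt := Int.lt_floor_add_one ((-1 / y + 1) / 2)
  have hne : T y ≠ -1 := by exact_mod_cast (irrational_T hy).ne_int (-1)
  refine abs_lt.2 ⟨lt_of_le_of_ne ?_ hne.symm, ?_⟩ <;> rw [T] <;> linarith

theorem floor_ne_zero_of_abs_lt_one (hy : Irrational y) (hy1 : |y| < 1) :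
    ⌊(-1 / y + 1) / 2⌋ ≠ 0 := fun h => by
  have hT := abs_T_lt_one hy
  rw [T, h, Int.cast_zero, mul_zero, sub_zero, abs_div, abs_neg, abs_one,
    div_lt_one (abs_pos.2 hy.ne_zero)] at hT
  linarith

/-- `x = (a y + b) / (c y + d)` for a matrix of determinant `1` with `|c| < |d|`, and
`y ∈ (-1, 1)` is irrational: the way in which the iterates `y = T^j x` are related to `x`. The
quantity `|a - c x| = 1 / |c y + d|` is then `|x T(x) ⋯ T^{j-1}(x)|`. -/
structure IsOrbit (x y : ℝ) (a b c d : ℤ) : Prop where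
  det : a * d - b * c = 1
  abs_lt_abs : |c| < |d|
  irrational : Irrational y
  abs_lt_one : |y| < 1
  eq : x * (c * y + d) = a * y + b

namespace IsOrbit

theorem step (h : IsOrbit x y a b c d) :
    IsOrbit x (T y) b (2 * ⌊(-1 / y + 1) / 2⌋ * b - a) d (2 * ⌊(-1 / y + 1) / 2⌋ * d - c) where
  det := by linear_combination h.det
  abs_lt_abs := by
    set k := ⌊(-1 / y + 1) / 2⌋
    have hk : 1 ≤ |k| := Int.one_le_abs (floor_ne_zero_of_abs_lt_one h.irrational h.abs_lt_one)
    have hdouble : 2 * |d| ≤ |2 * k * d| := by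
      rw [abs_mul, abs_mul, abs_two]
      nlinarith [abs_nonneg d]
    linarith [h.abs_lt_abs, abs_sub_abs_le_abs_sub (2 * k * d) c]
  irrational := irrational_T h.irrational
  abs_lt_one := abs_T_lt_one h.irrational
  eq := by
    have hy := h.irrational.ne_zero
    rw [T]
    push_cast
    field_simp
    linear_combination -h.eq

theorem abs_mul_abs_eq_one (h : IsOrbit x y a b c d) :
    |(a : ℝ) - c * x| * |(c : ℝ) * y + d| = 1 := by
  have hdet : (a : ℝ) * d - b * c = 1 := by exact_mod_cast h.det
  rw [← abs_mul, show ((a : ℝ) - c * x) * (c * y + d) = 1 by linear_combination hdet - c * h.eq,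
    abs_one]

theorem abs_sub_pos (h : IsOrbit x y a b c d) : 0 < |(a : ℝ) - c * x| :=
  (abs_nonneg _).lt_of_ne fun h0 => by simpa [← h0] using h.abs_mul_abs_eq_one

theorem abs_sub_le_one (h : IsOrbit x y a b c d) : |(a : ℝ) - c * x| ≤ 1 := by
  have hcd : |(c : ℝ)| + 1 ≤ |(d : ℝ)| := by exact_mod_cast Int.add_one_le_iff.2 h.abs_lt_abs
  have hcy : |(c : ℝ) * y| ≤ |(c : ℝ)| := by
    rw [abs_mul]
    exact mul_le_of_le_one_right (abs_nonneg _) h.abs_lt_one.le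
  have hsub := abs_sub_abs_le_abs_add (d : ℝ) (c * y)
  rw [add_comm] at hsub
  nlinarith [h.abs_mul_abs_eq_one, h.abs_sub_pos]

end IsOrbit

theorem exists_isOrbit (hx : Irrational x) (hx1 : |x| < 1) (J : ℕ) :
    ∃ a b c d : ℤ, IsOrbit x (T^[J] x) a b c d ∧ (J : ℤ) ≤ |c| ∧
      absProd x J = |(a : ℝ) - c * x| := by
  induction J with
  | zero =>
    exact ⟨1, 0, 0, 1, ⟨by norm_num, by norm_num, hx, hx1, by simp⟩, by simp, by simp [absProd]⟩
  | succ J ih =>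
    obtain ⟨a, b, c, d, h, hJ, hprod⟩ := ih
    refine ⟨_, _, _, _, Function.iterate_succ_apply' T J x ▸ h.step, ?_, ?_⟩
    · have := h.abs_lt_abs
      lia
    · rw [absProd, Finset.prod_range_succ, abs_mul, ← absProd, hprod, ← abs_mul, ← abs_neg]
      congr 1
      linear_combination h.eq

theorem abs_add_eq_sub_of_mul_nonpos {u v : ℝ} (huv : u * v ≤ 0) (h : |u| ≤ |v|) :
    |u + v| = |v| - |u| := by
  rw [← sq_eq_sq₀ (abs_nonneg _) (sub_nonneg.2 h), sq_abs, sub_sq, mul_assoc, mul_comm |v|,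
    ← abs_mul, abs_of_nonpos huv, sq_abs, sq_abs]
  ring

theorem abs_le_abs_add_of_mul_nonneg {u v : ℝ} (huv : 0 ≤ u * v) : |v| ≤ |u + v| := by
  rw [← sq_le_sq]
  nlinarith [sq_nonneg u]

namespace IsOrbit

theorem minDen_mul_le_one_of_nonneg (h : IsOrbit x y a b c d) (hc : c ≠ 0)
    (hcd : 0 ≤ c * y * d) : |(a : ℝ) - c * x| * minDen x |(c : ℝ)| ≤ 1 := by
  have hlt : |(c : ℝ)| < |(d : ℝ)| := by exact_mod_cast h.abs_lt_abs
  have hc0 : 0 < |(c : ℝ)| := abs_pos.2 (by exact_mod_cast hc)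
  have hθ := h.abs_sub_pos
  have hc1 : |(a : ℝ) - c * x| * |(c : ℝ)| ≤ 1 := by
    rw [← h.abs_mul_abs_eq_one]
    exact mul_le_mul_of_nonneg_left (hlt.le.trans (abs_le_abs_add_of_mul_nonneg hcd)) hθ.le
  refine le_trans ?_ hc1
  gcongr
  refine minDen_le_abs (p := a) hc ?_
  rwa [abs_sub_comm, le_div_iff₀ hc0]

theorem minDen_mul_le_one_of_nonpos (h : IsOrbit x y a b c d) (hc : c ≠ 0)
    (hcd : c * y * d ≤ 0) : |(a : ℝ) - c * x| * minDen x |(c : ℝ)| ≤ 1 := by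
  have hlt : |(c : ℝ)| < |(d : ℝ)| := by exact_mod_cast h.abs_lt_abs
  have hc0 : 0 < |(c : ℝ)| := abs_pos.2 (by exact_mod_cast hc)
  have hy := h.abs_lt_one
  have hθ := h.abs_sub_pos
  obtain ⟨σ, hσ, hσy⟩ : ∃ σ : ℤ, |(σ : ℝ)| = 1 ∧ y = σ * |y| := by
    rcases abs_choice y with habs | habs
    · exact ⟨1, by simp, by simp [habs]⟩
    · exact ⟨-1, by simp, by simp [habs]⟩
  have hone := h.abs_mul_abs_eq_one
  have hcy : |(c : ℝ) * y| = |(c : ℝ)| * |y| := abs_mul _ _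
  rw [abs_add_eq_sub_of_mul_nonpos hcd (by rw [hcy]; nlinarith), hcy] at hone
  have hden : |((σ * c + d : ℤ) : ℝ)| = |(d : ℝ)| - |(c : ℝ)| := by
    push_cast
    have hσc : |(σ : ℝ) * c| = |(c : ℝ)| := by rw [abs_mul, hσ, one_mul]
    rw [abs_add_eq_sub_of_mul_nonpos ?_ (hσc.trans_le hlt.le), hσc]
    refine nonpos_of_mul_nonpos_left (b := |y|) ?_ (abs_pos.2 h.irrational.ne_zero)
    calc (σ : ℝ) * c * d * |y| = c * (σ * |y|) * d := by ring
      _ ≤ 0 := by rwa [← hσy]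
  have hsmall : |((σ * c + d : ℤ) : ℝ) * x - ((b + σ * a : ℤ) : ℝ)| ≤ 1 / |(c : ℝ)| := by
    have hdecomp : ((σ * c + d : ℤ) : ℝ) * x - ((b + σ * a : ℤ) : ℝ) =
        -(σ * (1 - |y|) * (a - c * x)) := by
      push_cast
      linear_combination h.eq + (a - c * x) * hσy
    rw [hdecomp, abs_neg, abs_mul, abs_mul, hσ, one_mul, abs_of_pos (by linarith),
      le_div_iff₀ hc0]
    nlinarith
  have hne : σ * c + d ≠ 0 := fun h0 => by
    rw [h0, Int.cast_zero, abs_zero] at hden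
    linarith
  calc |(a : ℝ) - c * x| * minDen x |(c : ℝ)|
      ≤ |(a : ℝ) - c * x| * (|(d : ℝ)| - |(c : ℝ)|) := by
        gcongr
        exact hden ▸ minDen_le_abs hne hsmall
    _ ≤ |(a : ℝ) - c * x| * (|(d : ℝ)| - |(c : ℝ)| * |y|) := by
        gcongr
        exact mul_le_of_le_one_right hc0.le hy.le
    _ = 1 := hone

theorem minDen_mul_le_one (h : IsOrbit x y a b c d) (hc : c ≠ 0) :
    |(a : ℝ) - c * x| * minDen x |(c : ℝ)| ≤ 1 :=
  (le_total 0 (c * y * d)).elim (h.minDen_mul_le_one_of_nonneg hc)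
    (h.minDen_mul_le_one_of_nonpos hc)

theorem den_ne_zero (h : IsOrbit x y a b c d) {q p : ℤ} (hq : 1 ≤ q)
    (hp : |q * y - p| < 1) : c * p + d * q ≠ 0 := fun hden => by
  have hnum : ((a * p + b * q : ℤ) : ℝ) = -((q * y - p) * (a - c * x)) := by
    have hden' : (c : ℝ) * p + d * q = 0 := by exact_mod_cast hden
    push_cast
    linear_combination x * hden' - q * h.eq
  have hnum0 : a * p + b * q = 0 := by
    rw [← Int.abs_lt_one_iff, ← Int.cast_lt (R := ℝ), Int.cast_abs, hnum, abs_neg, abs_mul,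
      Int.cast_one]
    exact mul_lt_one_of_nonneg_of_lt_one_left (abs_nonneg _) hp h.abs_sub_le_one
  have hq0 : q = 0 := by
    linear_combination a * hden - c * hnum0 - q * h.det
  lia

-- A good approximation `p / q` of `y` is mapped to the good approximation
-- `(a p + b q) / (c p + d q)` of `x`.
theorem minDen_le_of_approx (h : IsOrbit x y a b c d) {N : ℕ} (hN : 1 ≤ N)
    (hcN : |(c : ℝ)| * |(a : ℝ) - c * x| ≤ N) {q p : ℤ} (hq : 1 ≤ q)
    (hp : |q * y - p| ≤ 1 / (2 * N)) :
    |(a : ℝ) - c * x| * minDen x (N / |(a : ℝ) - c * x|) ≤ 3 / 2 * q := by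
  set θ := |(a : ℝ) - c * x|
  have hN' : (1 : ℝ) ≤ N := by exact_mod_cast hN
  have hq' : (1 : ℝ) ≤ q := by exact_mod_cast hq
  have hθ0 : 0 < θ := h.abs_sub_pos
  have happrox : |((c * p + d * q : ℤ) : ℝ) * x - ((a * p + b * q : ℤ) : ℝ)| ≤ 1 / (N / θ) := by
    have hdecomp : ((c * p + d * q : ℤ) : ℝ) * x - ((a * p + b * q : ℤ) : ℝ) =
        (q * y - p) * (a - c * x) := by
      push_cast
      linear_combination q * h.eq
    calc |((c * p + d * q : ℤ) : ℝ) * x - ((a * p + b * q : ℤ) : ℝ)|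
        = |q * y - p| * θ := by rw [hdecomp, abs_mul]
      _ ≤ 1 / N * θ := by
          gcongr
          exact hp.trans (one_div_le_one_div_of_le (by linarith) (by linarith))
      _ = 1 / (N / θ) := by rw [one_div_div]; ring
  have hden : |((c * p + d * q : ℤ) : ℝ)| ≤ q * |(c : ℝ) * y + d| + |(c : ℝ)| * (1 / (2 * N)) := by
    calc |((c * p + d * q : ℤ) : ℝ)| = |q * (c * y + d) - c * (q * y - p)| := by
          push_cast; ring_nf
      _ ≤ |q * (c * y + d)| + |c * (q * y - p)| := abs_sub _ _
      _ ≤ q * |(c : ℝ) * y + d| + |(c : ℝ)| * (1 / (2 * N)) := by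
          rw [abs_mul, abs_mul (c : ℝ), abs_of_pos (by linarith : (0 : ℝ) < q)]
          gcongr
  have hne := h.den_ne_zero hq (hp.trans_lt ((div_lt_one (by positivity)).2 (by linarith)))
  calc θ * (minDen x (N / θ) : ℝ)
      ≤ θ * (q * |(c : ℝ) * y + d| + |(c : ℝ)| * (1 / (2 * N))) := by
        gcongr
        exact (minDen_le_abs hne happrox).trans hden
    _ = q * (θ * |(c : ℝ) * y + d|) + |(c : ℝ)| * θ / N * (1 / 2) := by field_simp
    _ ≤ q * 1 + 1 * (1 / 2) := by
        rw [h.abs_mul_abs_eq_one]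
        gcongr
        exact (div_le_one (by positivity)).2 hcN
    _ ≤ 3 / 2 * q := by linarith

theorem norm_weylSum_le_of_lt (h : IsOrbit x y a b c d) {N : ℕ} (hN : 1 ≤ N)
    (hlt : N < |(c : ℝ)| * |(a : ℝ) - c * x|) :
    ‖weylSum y N‖ ≤ N / √(|(a : ℝ) - c * x| * minDen x (N / |(a : ℝ) - c * x|)) := by
  set θ := |(a : ℝ) - c * x|
  have hN' : (1 : ℝ) ≤ N := by exact_mod_cast hN
  have hθ0 : 0 < θ := h.abs_sub_pos
  have hc : c ≠ 0 := by
    rintro rfl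
    simp only [Int.cast_zero, abs_zero, zero_mul] at hlt
    linarith
  have hM : 0 < N / θ := by positivity
  have hone : (1 : ℝ) ≤ minDen x (N / θ) := by exact_mod_cast one_le_minDen x hM
  have hmono : minDen x (N / θ) ≤ minDen x |(c : ℝ)| :=
    minDen_mono x hM ((div_le_iff₀ hθ0).2 hlt.le)
  have hle : θ * minDen x (N / θ) ≤ 1 :=
    le_trans (by gcongr) (h.minDen_mul_le_one hc)
  refine (ThetaSeries.norm_weylSum_le y N).trans ?_
  rw [le_div_iff₀ (Real.sqrt_pos.2 (by positivity))]
  exact mul_le_of_le_one_right (by positivity) (Real.sqrt_le_one.2 hle)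

theorem norm_weylSum_le_of_le (h : IsOrbit x y a b c d) {N : ℕ} (hN : 1 ≤ N)
    (hle : |(c : ℝ)| * |(a : ℝ) - c * x| ≤ N) :
    ‖weylSum y N‖ ≤ 8 * (N / √(|(a : ℝ) - c * x| * minDen x (N / |(a : ℝ) - c * x|)) +
      √(N * (1 + Real.log N))) := by
  obtain ⟨r, hr, hrN⟩ := Real.exists_rat_abs_sub_le_and_den_le y (n := 2 * N) (by lia)
  push_cast at hr
  have hden : (0 : ℝ) < r.den := by exact_mod_cast r.den_pos
  have happrox : |((r.den : ℤ) : ℝ) * y - r.num| ≤ 1 / (2 * N) := by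
    calc |((r.den : ℤ) : ℝ) * y - r.num| = r.den * |y - r| := by
          have hnum : (r : ℝ) * r.den = r.num := by exact_mod_cast Rat.mul_den_eq_num r
          rw [← hnum, Int.cast_natCast, mul_comm (r : ℝ), ← mul_sub, abs_mul, abs_of_pos hden]
      _ ≤ r.den * (1 / ((2 * N + 1) * r.den)) := by gcongr
      _ = 1 / (2 * N + 1) := by field_simp
      _ ≤ 1 / (2 * N) := one_div_le_one_div_of_le (by positivity) (by linarith)
  have hminDen := h.minDen_le_of_approx hN hle (by exact_mod_cast r.den_pos) happrox
  have hweyl := norm_weylSum_sq_le_of_approx hN hr hrN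
  have hM : 0 < N / |(a : ℝ) - c * x| := div_pos (by positivity) h.abs_sub_pos
  have hone : (1 : ℝ) ≤ minDen x (N / |(a : ℝ) - c * x|) := by exact_mod_cast one_le_minDen x hM
  set D := |(a : ℝ) - c * x| * minDen x (N / |(a : ℝ) - c * x|) with hD
  have hD0 : 0 < D := mul_pos h.abs_sub_pos (by linarith)
  have hmain : (N : ℝ) ^ 2 / r.den ≤ 3 / 2 * (N / √D) ^ 2 := by
    rw [div_pow, Real.sq_sqrt hD0.le, ← mul_div_assoc, div_le_div_iff₀ hden hD0]
    rw [Int.cast_natCast] at hminDen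
    nlinarith [sq_nonneg (N : ℝ)]
  have hlog : 0 ≤ N * (1 + Real.log N) := by
    have := Real.log_natCast_nonneg N
    positivity
  rw [← Real.sq_sqrt hlog] at hweyl
  refine le_of_sq_le_sq ?_ (by positivity)
  have hA : 0 ≤ N / √D := by positivity
  nlinarith [mul_nonneg hA (Real.sqrt_nonneg (N * (1 + Real.log N))),
    sq_nonneg (√(N * (1 + Real.log N)))]

theorem norm_weylSum_le (h : IsOrbit x y a b c d) {N : ℕ} (hN : 1 ≤ N) :
    ‖weylSum y N‖ ≤ 8 * (N / √(|(a : ℝ) - c * x| * minDen x (N / |(a : ℝ) - c * x|)) +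
      √(N * (1 + Real.log N))) := by
  rcases lt_or_ge (N : ℝ) (|(c : ℝ)| * |(a : ℝ) - c * x|) with hlt | hle
  · have hpos : 0 ≤ N / √(|(a : ℝ) - c * x| * minDen x (N / |(a : ℝ) - c * x|)) := by positivity
    linarith [h.norm_weylSum_le_of_lt hN hlt, Real.sqrt_nonneg (N * (1 + Real.log N))]
  · exact h.norm_weylSum_le_of_le hN hle

end IsOrbit

end Orbits

section SummationByParts

theorem partialF_eq_sum_weylSum (s y : ℝ) (N : ℕ) :
    partialF s y N = weylSum y N * ((((N : ℝ) + 1) ^ (-s) : ℝ) : ℂ) +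
      ∑ k ∈ Finset.range N, weylSum y (k + 1) *
        ((((k : ℝ) + 1) ^ (-s) - ((k : ℝ) + 1 + 1) ^ (-s) : ℝ) : ℂ) := by
  induction N with
  | zero => simp [partialF, weylSum]
  | succ N ih =>
    have hpartialF : partialF s y (N + 1) = partialF s y N +
        Complex.exp ((π * ((N : ℝ) + 1) ^ 2 * y : ℝ) * Complex.I) *
          ((((N : ℝ) + 1) ^ (-s) : ℝ) : ℂ) := by
      rw [partialF, partialF, Finset.sum_Icc_succ_top (by lia),
        Real.rpow_neg (by positivity), Complex.ofReal_inv, ← div_eq_mul_inv]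
      congr 2
      · push_cast
        ring_nf
      · push_cast
        rfl
    have hweylSum : weylSum y (N + 1) = weylSum y N +
        Complex.exp ((π * ((N : ℝ) + 1) ^ 2 * y : ℝ) * Complex.I) := Finset.sum_range_succ _ _
    rw [hpartialF, ih, Finset.sum_range_succ, hweylSum, Complex.ofReal_sub]
    push_cast
    ring

theorem rpow_neg_sub_add_one_rpow_neg_le {s t : ℝ} (hs : 0 ≤ s) (ht : 0 < t) :
    t ^ (-s) - (t + 1) ^ (-s) ≤ s * t ^ (-(s + 1)) := by
  have ht1 : 0 < (t + 1) / t := by positivity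
  have hlog : Real.log ((t + 1) / t) ≤ 1 / t := by
    refine (Real.log_le_sub_one_of_pos ht1).trans_eq ?_
    field_simp
    ring
  have hbernoulli : 1 - s * (1 / t) ≤ ((t + 1) / t) ^ (-s) := by
    rw [Real.rpow_def_of_pos ht1]
    refine le_trans ?_ (Real.add_one_le_exp _)
    nlinarith
  calc t ^ (-s) - (t + 1) ^ (-s) = t ^ (-s) * (1 - ((t + 1) / t) ^ (-s)) := by
        rw [mul_one_sub, ← Real.mul_rpow ht.le ht1.le, mul_div_cancel₀ _ ht.ne']
    _ ≤ t ^ (-s) * (s * (1 / t)) := by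
        gcongr
        linarith
    _ = s * t ^ (-(s + 1)) := by
        rw [neg_add, Real.rpow_add ht, Real.rpow_neg_one, one_div]
        ring

theorem exists_tendsto_partialF {s y G : ℝ} (hs : 0 < s)
    (hG : ∀ n, ∑ k ∈ Finset.range n, ‖weylSum y (k + 1)‖ * ((k : ℝ) + 1) ^ (-(s + 1)) ≤ G)
    (h0 : Tendsto (fun N : ℕ => ‖weylSum y N‖ * (N : ℝ) ^ (-s)) atTop (𝓝 0)) :
    ∃ F : ℂ, Tendsto (partialF s y) atTop (𝓝 F) ∧ ‖F‖ ≤ s * G := by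
  have hsummable : Summable fun k : ℕ => ‖weylSum y (k + 1)‖ * ((k : ℝ) + 1) ^ (-(s + 1)) :=
    summable_of_sum_range_le (fun k => by positivity) hG
  have hbound : ∀ k : ℕ, ‖weylSum y (k + 1) *
      ((((k : ℝ) + 1) ^ (-s) - ((k : ℝ) + 1 + 1) ^ (-s) : ℝ) : ℂ)‖ ≤
        s * (‖weylSum y (k + 1)‖ * ((k : ℝ) + 1) ^ (-(s + 1))) := fun k => by
    have hle : ((k : ℝ) + 1 + 1) ^ (-s) ≤ ((k : ℝ) + 1) ^ (-s) :=
      Real.rpow_le_rpow_of_nonpos (by positivity) (by linarith) (by linarith)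
    rw [norm_mul, Complex.norm_real, Real.norm_of_nonneg (sub_nonneg.2 hle), mul_left_comm]
    gcongr
    exact rpow_neg_sub_add_one_rpow_neg_le hs.le (by positivity)
  have hboundary : Tendsto (fun N : ℕ => weylSum y N * ((((N : ℝ) + 1) ^ (-s) : ℝ) : ℂ))
      atTop (𝓝 0) := by
    refine squeeze_zero_norm' ?_ h0
    filter_upwards [eventually_ge_atTop 1] with N hN
    rw [norm_mul, Complex.norm_real, Real.norm_of_nonneg (by positivity)]
    gcongr ?_ * ?_
    exact Real.rpow_le_rpow_of_nonpos (by positivity) (by linarith) (by linarith)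
  have hseries := Summable.of_norm_bounded (hsummable.mul_left s) hbound
  refine ⟨_, (hboundary.add hseries.hasSum.tendsto_sum_nat).congr fun N =>
    (partialF_eq_sum_weylSum s y N).symm, ?_⟩
  rw [zero_add]
  refine (tsum_of_norm_bounded (hsummable.mul_left s).hasSum hbound).trans ?_
  rw [tsum_mul_left]
  gcongr
  exact hsummable.tsum_le_of_sum_range_le hG

end SummationByParts

section Antitone

variable {f : ℝ → ℝ}

theorem integrableOn_Ioi_of_antitoneOn (hf : AntitoneOn f (Ioi 0)) {a b : ℝ}
    (hint : IntegrableOn f (Ioi a)) (hb : 0 < b) : IntegrableOn f (Ioi b) := by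
  have hIcc : IntegrableOn f (Icc b (max a b)) :=
    (hf.mono fun t ht => hb.trans_le ht.1).integrableOn_isCompact isCompact_Icc
  refine (hIcc.union hint).mono_set fun t ht => ?_
  exact (lt_or_ge a t).elim Or.inr fun hta => Or.inl ⟨(mem_Ioi.1 ht).le, le_max_of_le_left hta⟩

theorem sum_mul_le_integral_Ioi (hf : AntitoneOn f (Ioi 0)) (hf0 : ∀ t ∈ Ioi 0, 0 ≤ f t) {t : ℝ}
    (ht : 0 < t) (hint : IntegrableOn f (Ioi t)) (n : ℕ) :
    ∑ k ∈ Finset.range n, t * f (t * (1 + (k + 1 : ℕ))) ≤ ∫ u in Ioi t, f u := by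
  have hanti : AntitoneOn (fun u => f (t * u)) (Icc 1 (1 + n)) := fun u hu v hv huv =>
    hf (mul_pos ht (zero_lt_one.trans_le hu.1)) (mul_pos ht (zero_lt_one.trans_le hv.1)) (by gcongr)
  calc ∑ k ∈ Finset.range n, t * f (t * (1 + (k + 1 : ℕ)))
      ≤ t * ∫ u in (1 : ℝ)..1 + n, f (t * u) := by
        rw [← Finset.mul_sum]
        gcongr
        exact hanti.sum_le_integral
    _ = ∫ u in t..t * (1 + n), f u := by
        rw [intervalIntegral.mul_integral_comp_mul_left, mul_one]
    _ ≤ ∫ u in Ioi t, f u := by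
        rw [intervalIntegral.integral_of_le (le_mul_of_one_le_right ht.le (by simp))]
        refine setIntegral_mono_set hint ?_ Ioc_subset_Ioi_self.eventuallyLE
        exact ae_restrict_of_forall_mem measurableSet_Ioi fun u hu => hf0 u (ht.trans hu)

theorem sum_mul_le_two_mul_integral_Ioi (hf : AntitoneOn f (Ioi 0)) (hf0 : ∀ t ∈ Ioi 0, 0 ≤ f t)
    {t : ℝ} (ht : 0 < t) (hint : IntegrableOn f (Ioi (t / 2))) (n : ℕ) :
    ∑ k ∈ Finset.range n, t * f ((k + 1) * t) ≤ 2 * ∫ u in Ioi (t / 2), f u := by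
  calc ∑ k ∈ Finset.range n, t * f ((k + 1) * t)
      ≤ ∑ k ∈ Finset.range n, 2 * (t / 2 * f (t / 2 * (1 + (k + 1 : ℕ)))) := by
        refine Finset.sum_le_sum fun k _ => ?_
        rw [← mul_assoc, mul_div_cancel₀ t two_ne_zero]
        gcongr
        refine hf (mem_Ioi.2 (by positivity)) (mem_Ioi.2 (by positivity)) ?_
        push_cast
        nlinarith [mul_nonneg (Nat.cast_nonneg (α := ℝ) k) ht.le]
    _ ≤ 2 * ∫ u in Ioi (t / 2), f u := by
        rw [← Finset.mul_sum]
        gcongr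
        exact sum_mul_le_integral_Ioi hf hf0 (half_pos ht) hint n

theorem mul_le_two_mul_integral_Ioi (hf : AntitoneOn f (Ioi 0)) (hf0 : ∀ t ∈ Ioi 0, 0 ≤ f t)
    {t : ℝ} (ht : 0 < t) (hint : IntegrableOn f (Ioi (t / 2))) :
    t * f t ≤ 2 * ∫ u in Ioi (t / 2), f u := by
  simpa only [Finset.sum_range_one, Nat.cast_zero, zero_add, one_mul] using
    sum_mul_le_two_mul_integral_Ioi hf hf0 ht hint 1

end Antitone

section LogSeries

variable {s : ℝ}

theorem sqrt_one_add_log_le (hs : 1 / 2 < s) {t : ℝ} (ht : 1 ≤ t) :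
    √(1 + Real.log t) ≤ √(1 + 1 / (s - 1 / 2)) * t ^ ((s - 1 / 2) / 2) := by
  have hδ : 0 < s - 1 / 2 := by linarith
  have hle : 1 + Real.log t ≤ (1 + 1 / (s - 1 / 2)) * t ^ (s - 1 / 2) := by
    rw [one_add_mul, one_div_mul_eq_div]
    exact add_le_add (Real.one_le_rpow ht hδ.le) (Real.log_le_rpow_div (by linarith) hδ)
  refine (Real.sqrt_le_sqrt hle).trans_eq ?_
  rw [Real.sqrt_mul (by positivity), Real.sqrt_eq_rpow (t ^ (s - 1 / 2)),
    ← Real.rpow_mul (by linarith), mul_one_div]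

theorem sqrt_one_add_log_mul_rpow_le (hs : 1 / 2 < s) {t : ℝ} (ht : 1 ≤ t) (r : ℝ) :
    √(1 + Real.log t) * t ^ r ≤ √(1 + 1 / (s - 1 / 2)) * t ^ ((s - 1 / 2) / 2 + r) := by
  have ht0 : 0 < t := by linarith
  rw [Real.rpow_add ht0, ← mul_assoc]
  gcongr
  exact sqrt_one_add_log_le hs ht

theorem summable_sqrt_one_add_log_mul_rpow (hs : 1 / 2 < s) :
    Summable fun k : ℕ => √(1 + Real.log (k + 1)) * ((k : ℝ) + 1) ^ (-(s + 1 / 2)) := by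
  have hrpow : Summable fun k : ℕ => ((k : ℝ) + 1) ^ ((s - 1 / 2) / 2 + -(s + 1 / 2)) := by
    simpa only [Nat.cast_succ] using
      (summable_nat_add_iff 1).2 (Real.summable_nat_rpow.2 (by linarith))
  exact Summable.of_nonneg_of_le (fun k => by positivity)
    (fun k => sqrt_one_add_log_mul_rpow_le hs (by simp) _) (hrpow.mul_left _)

theorem tendsto_sqrt_one_add_log_mul_rpow (hs : 1 / 2 < s) :
    Tendsto (fun t : ℝ => √(1 + Real.log t) * t ^ (1 / 2 - s)) atTop (𝓝 0) := by
  have hrpow := (tendsto_rpow_neg_atTop (y := (s - 1 / 2) / 2) (by linarith)).const_mul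
    (√(1 + 1 / (s - 1 / 2)))
  rw [mul_zero] at hrpow
  refine squeeze_zero' ?_ ?_ hrpow
  · filter_upwards [eventually_ge_atTop 0] with t ht
    positivity
  · filter_upwards [eventually_ge_atTop 1] with t ht
    refine (sqrt_one_add_log_mul_rpow_le hs ht _).trans_eq ?_
    ring_nf

end LogSeries

section Convergence

variable {s x : ℝ}

/-- The function `M ↦ M^{-s} / √ψ(M)`, where `ψ = minDen x`: its integrability at infinity is the
Diophantine condition on `x` under which the series for `F_s(x)` converge. -/
def dioph (s x M : ℝ) : ℝ := M ^ (-s) / √(minDen x M)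

theorem dioph_nonneg {M : ℝ} (hM : M ∈ Ioi 0) : 0 ≤ dioph s x M :=
  div_nonneg (Real.rpow_nonneg (le_of_lt hM) _) (Real.sqrt_nonneg _)

theorem antitoneOn_dioph (hs : 0 ≤ s) (x : ℝ) : AntitoneOn (dioph s x) (Ioi 0) := by
  intro M hM M' _ h
  have hone : (0 : ℝ) < minDen x M := by exact_mod_cast one_le_minDen x hM
  have hM0 : 0 < M := hM
  rw [dioph, dioph]
  gcongr ?_ / √(?_ : ℝ)
  · exact Real.rpow_le_rpow_of_nonpos hM0 h (by linarith)
  · exact_mod_cast minDen_mono x hM h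

theorem rpow_div_sqrt_eq_mul_dioph {θ t : ℝ} (hθ : 0 < θ) (ht : 0 < t) :
    t ^ (-s) / √(θ * minDen x (t / θ)) = θ ^ (1 / 2 - s) * (θ⁻¹ * dioph s x (t * θ⁻¹)) := by
  have hθ_rpow : θ ^ (1 / 2 - s) * θ⁻¹ * (θ⁻¹) ^ (-s) = (√θ)⁻¹ := by
    rw [Real.inv_rpow hθ.le, Real.rpow_neg hθ.le, inv_inv, ← Real.rpow_neg_one,
      ← Real.rpow_add hθ, ← Real.rpow_add hθ, Real.sqrt_eq_rpow, ← Real.rpow_neg hθ.le]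
    ring_nf
  rw [dioph, Real.mul_rpow ht.le (inv_nonneg.2 hθ.le), Real.sqrt_mul hθ.le, ← div_eq_mul_inv t]
  linear_combination -t ^ (-s) / √(minDen x (t / θ)) * hθ_rpow

namespace IsOrbit

variable {y : ℝ} {a b c d : ℤ}

theorem norm_weylSum_mul_rpow_le (h : IsOrbit x y a b c d) {N : ℕ} (hN : 1 ≤ N) :
    ‖weylSum y N‖ * (N : ℝ) ^ (-(s + 1)) ≤
      8 * (|(a : ℝ) - c * x| ^ (1 / 2 - s) *
          (|(a : ℝ) - c * x|⁻¹ * dioph s x (N * |(a : ℝ) - c * x|⁻¹)) +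
        √(1 + Real.log N) * (N : ℝ) ^ (-(s + 1 / 2))) := by
  have hN0 : (0 : ℝ) < N := by exact_mod_cast hN
  have hN_rpow : (N : ℝ) * (N : ℝ) ^ (-(s + 1)) = (N : ℝ) ^ (-s) := by
    rw [neg_add', Real.rpow_sub_one hN0.ne', mul_div_cancel₀ _ hN0.ne']
  have hN_sqrt : √(N : ℝ) * (N : ℝ) ^ (-(s + 1)) = (N : ℝ) ^ (-(s + 1 / 2)) := by
    rw [Real.sqrt_eq_rpow, ← Real.rpow_add hN0]
    ring_nf
  rw [← rpow_div_sqrt_eq_mul_dioph h.abs_sub_pos hN0, ← hN_rpow, ← hN_sqrt]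
  calc ‖weylSum y N‖ * (N : ℝ) ^ (-(s + 1))
      ≤ 8 * (N / √(|(a : ℝ) - c * x| * minDen x (N / |(a : ℝ) - c * x|)) +
          √(N * (1 + Real.log N))) * (N : ℝ) ^ (-(s + 1)) := by
        gcongr
        exact h.norm_weylSum_le hN
    _ = _ := by
        rw [Real.sqrt_mul hN0.le]
        ring

theorem sum_norm_weylSum_mul_rpow_le (h : IsOrbit x y a b c d) (hs : 1 / 2 < s) {A : ℝ}
    (hint : IntegrableOn (dioph s x) (Ioi A)) (n : ℕ) :
    ∑ k ∈ Finset.range n, ‖weylSum y (k + 1)‖ * ((k : ℝ) + 1) ^ (-(s + 1)) ≤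
      8 * (|(a : ℝ) - c * x| ^ (1 / 2 - s) *
          (2 * ∫ t in Ioi (|(a : ℝ) - c * x|⁻¹ / 2), dioph s x t) +
        ∑' k : ℕ, √(1 + Real.log (k + 1)) * ((k : ℝ) + 1) ^ (-(s + 1 / 2))) := by
  have hθ := inv_pos.2 h.abs_sub_pos
  have hanti := antitoneOn_dioph (s := s) (by linarith) x
  have hint' := integrableOn_Ioi_of_antitoneOn hanti hint (half_pos hθ)
  calc ∑ k ∈ Finset.range n, ‖weylSum y (k + 1)‖ * ((k : ℝ) + 1) ^ (-(s + 1))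
      ≤ ∑ k ∈ Finset.range n, 8 * (|(a : ℝ) - c * x| ^ (1 / 2 - s) *
          (|(a : ℝ) - c * x|⁻¹ * dioph s x ((k + 1) * |(a : ℝ) - c * x|⁻¹)) +
        √(1 + Real.log (k + 1)) * ((k : ℝ) + 1) ^ (-(s + 1 / 2))) :=
        Finset.sum_le_sum fun k _ => mod_cast h.norm_weylSum_mul_rpow_le k.succ_pos
    _ ≤ _ := by
        rw [← Finset.mul_sum, Finset.sum_add_distrib, ← Finset.mul_sum]
        gcongr
        · exact sum_mul_le_two_mul_integral_Ioi hanti (fun _ => dioph_nonneg) hθ hint' n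
        · exact (summable_sqrt_one_add_log_mul_rpow hs).sum_le_tsum _ fun k _ => by positivity

theorem tendsto_norm_weylSum_mul_rpow (h : IsOrbit x y a b c d) (hs : 1 / 2 < s) {A : ℝ}
    (hint : IntegrableOn (dioph s x) (Ioi A)) :
    Tendsto (fun N : ℕ => ‖weylSum y N‖ * (N : ℝ) ^ (-s)) atTop (𝓝 0) := by
  have hθ := inv_pos.2 h.abs_sub_pos
  have hscale : Tendsto (fun N : ℕ => N * |(a : ℝ) - c * x|⁻¹ / 2) atTop atTop :=
    (tendsto_natCast_atTop_atTop.atTop_mul_const hθ).atTop_div_const two_pos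
  have hbound := ((((tendsto_integral_Ioi_zero (μ := volume) (f := dioph s x) hscale).const_mul
    2).const_mul (|(a : ℝ) - c * x| ^ (1 / 2 - s))).add
      ((tendsto_sqrt_one_add_log_mul_rpow hs).comp tendsto_natCast_atTop_atTop)).const_mul 8
  rw [mul_zero, mul_zero, add_zero, mul_zero] at hbound
  refine squeeze_zero' (Eventually.of_forall fun N => by positivity) ?_ hbound
  filter_upwards [eventually_ge_atTop 1] with N hN
  have hN0 : (0 : ℝ) < N := by exact_mod_cast hN
  have hanti := antitoneOn_dioph (s := s) (by linarith) x
  have hdioph := mul_le_two_mul_integral_Ioi hanti (fun _ => dioph_nonneg)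
    (mul_pos hN0 hθ) (integrableOn_Ioi_of_antitoneOn hanti hint (by positivity))
  calc ‖weylSum y N‖ * (N : ℝ) ^ (-s) = N * (‖weylSum y N‖ * (N : ℝ) ^ (-(s + 1))) := by
        rw [mul_left_comm, neg_add', Real.rpow_sub_one hN0.ne', mul_div_cancel₀ _ hN0.ne']
    _ ≤ N * (8 * (|(a : ℝ) - c * x| ^ (1 / 2 - s) *
          (|(a : ℝ) - c * x|⁻¹ * dioph s x (N * |(a : ℝ) - c * x|⁻¹)) +
        √(1 + Real.log N) * (N : ℝ) ^ (-(s + 1 / 2)))) := by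
        gcongr ?_ * ?_
        exact h.norm_weylSum_mul_rpow_le hN
    _ = 8 * (|(a : ℝ) - c * x| ^ (1 / 2 - s) *
          (N * |(a : ℝ) - c * x|⁻¹ * dioph s x (N * |(a : ℝ) - c * x|⁻¹)) +
        √(1 + Real.log N) * (N : ℝ) ^ (1 / 2 - s)) := by
        rw [show 1 / 2 - s = -(s + 1 / 2) + 1 by ring, Real.rpow_add_one hN0.ne']
        ring
    _ ≤ _ := by
        dsimp only [Function.comp_apply]
        gcongr

theorem exists_tendsto_partialF (h : IsOrbit x y a b c d) (hs : 1 / 2 < s) {A : ℝ}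
    (hint : IntegrableOn (dioph s x) (Ioi A)) :
    ∃ F : ℂ, Tendsto (partialF s y) atTop (𝓝 F) ∧
      |(a : ℝ) - c * x| ^ (s - 1 / 2) * ‖F‖ ≤
        8 * s * (2 * (∫ t in Ioi (|(a : ℝ) - c * x|⁻¹ / 2), dioph s x t) +
          |(a : ℝ) - c * x| ^ (s - 1 / 2) *
            ∑' k : ℕ, √(1 + Real.log (k + 1)) * ((k : ℝ) + 1) ^ (-(s + 1 / 2))) := by
  obtain ⟨F, hF, hF_le⟩ := ThetaSeries.exists_tendsto_partialF (by linarith)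
    (h.sum_norm_weylSum_mul_rpow_le hs hint) (h.tendsto_norm_weylSum_mul_rpow hs hint)
  have hcancel : |(a : ℝ) - c * x| ^ (s - 1 / 2) * |(a : ℝ) - c * x| ^ (1 / 2 - s) = 1 := by
    rw [← Real.rpow_add h.abs_sub_pos, sub_add_sub_cancel, sub_self, Real.rpow_zero]
  refine ⟨F, hF, (mul_le_mul_of_nonneg_left hF_le (by positivity)).trans_eq ?_⟩
  linear_combination
    16 * s * (∫ t in Ioi (|(a : ℝ) - c * x|⁻¹ / 2), dioph s x t) * hcancel

end IsOrbit

theorem absProd_nonneg (x : ℝ) (J : ℕ) : 0 ≤ absProd x J := abs_nonneg _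

theorem absProd_pos (hx : Irrational x) (hx1 : |x| < 1) (J : ℕ) : 0 < absProd x J := by
  obtain ⟨_, _, _, _, h, -, hJ⟩ := exists_isOrbit hx hx1 J
  exact hJ ▸ h.abs_sub_pos

theorem tendsto_absProd (hx : Irrational x) (hx1 : |x| < 1) :
    Tendsto (absProd x) atTop (𝓝[>] 0) := by
  refine tendsto_nhdsWithin_iff.2 ⟨?_, Eventually.of_forall (absProd_pos hx hx1)⟩
  have hψ : Tendsto (fun J : ℕ => (minDen x J : ℝ)⁻¹) atTop (𝓝 0) :=
    (tendsto_natCast_atTop_atTop.comp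
      ((tendsto_minDen_atTop hx).comp tendsto_natCast_atTop_atTop)).inv_tendsto_atTop
  refine squeeze_zero' (Eventually.of_forall (absProd_nonneg x)) ?_ hψ
  filter_upwards [eventually_ge_atTop 1] with J hJ
  obtain ⟨a, b, c, d, h, hc, habsProd⟩ := exists_isOrbit hx hx1 J
  have hc0 : c ≠ 0 := by
    rintro rfl
    rw [abs_zero] at hc
    lia
  have hJ0 : (0 : ℝ) < J := by exact_mod_cast hJ
  have hone : (0 : ℝ) < minDen x J := by exact_mod_cast one_le_minDen x hJ0
  rw [habsProd, ← one_div, le_div_iff₀ hone]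
  refine le_trans ?_ (h.minDen_mul_le_one hc0)
  gcongr
  exact minDen_mono x hJ0 (by exact_mod_cast hc)

theorem norm_phase (x : ℝ) (J : ℕ) : ‖phase x J‖ = 1 := by
  rw [phase, Complex.norm_exp]
  simp

theorem phase_succ (x : ℝ) (J : ℕ) : phase x (J + 1) =
    phase x J * Complex.exp (Complex.I * (π / 4) * (Real.sign (T^[J] x) : ℝ)) := by
  rw [phase, phase, ← Complex.exp_add, Finset.sum_range_succ, Complex.ofReal_add, mul_add]

theorem absProd_succ (x : ℝ) (J : ℕ) : absProd x (J + 1) = absProd x J * |T^[J] x| := by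
  rw [absProd, absProd, Finset.prod_range_succ, abs_mul]

theorem eq_sum_add_of_tendsto_partialF (hs : 0 < s) (hx : ∀ J, T^[J] x ≠ 0) {F : ℕ → ℂ}
    (hF : ∀ J, Tendsto (partialF s (T^[J] x)) atTop (𝓝 (F J))) (J : ℕ) :
    F 0 = (∑ j ∈ Finset.range J,
        phase x j * ((absProd x j ^ (s - 1 / 2) : ℝ) : ℂ) * Omega s (T^[j] x)) +
      phase x J * ((absProd x J ^ (s - 1 / 2) : ℝ) : ℂ) * F J := by
  induction J with
  | zero => simp [phase, absProd]
  | succ J ih =>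
    have hstep : F J = Complex.exp (Complex.I * (π / 4) * (Real.sign (T^[J] x) : ℝ)) *
        ((|T^[J] x| ^ (s - 1 / 2) : ℝ) : ℂ) * F (J + 1) + Omega s (T^[J] x) := by
      refine tendsto_nhds_unique (hF J) (tendsto_partialF hs (hx J) ?_)
      refine (hF (J + 1)).congr fun N => ?_
      rw [Function.iterate_succ_apply', partialF_T]
    rw [Finset.sum_range_succ, ih, hstep, phase_succ, absProd_succ,
      Real.mul_rpow (absProd_nonneg x J) (abs_nonneg _)]
    push_cast
    ring

theorem fEqualsSeries_of_tendsto_partialF (hs : 0 < s) (hx : ∀ J, T^[J] x ≠ 0) {F : ℕ → ℂ}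
    (hF : ∀ J, Tendsto (partialF s (T^[J] x)) atTop (𝓝 (F J)))
    (h0 : Tendsto (fun J => absProd x J ^ (s - 1 / 2) * ‖F J‖) atTop (𝓝 0)) :
    FEqualsSeries s x fun j =>
      phase x j * ((absProd x j ^ (s - 1 / 2) : ℝ) : ℂ) * Omega s (T^[j] x) := by
  have hremainder : Tendsto (fun J => phase x J * ((absProd x J ^ (s - 1 / 2) : ℝ) : ℂ) * F J)
      atTop (𝓝 0) := by
    refine squeeze_zero_norm (fun J => le_of_eq ?_) h0
    rw [norm_mul, norm_mul, norm_phase, one_mul, Complex.norm_real,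
      Real.norm_of_nonneg (Real.rpow_nonneg (absProd_nonneg x J) _)]
  have hseries := hremainder.const_sub (F 0)
  rw [sub_zero] at hseries
  refine ⟨F 0, hF 0, hseries.congr fun J => ?_⟩
  rw [eq_sum_add_of_tendsto_partialF hs hx hF J, add_sub_cancel_right]

theorem fEqualsSeries_of_integrableOn_dioph (hs : 1 / 2 < s) (hx : Irrational x) (hx1 : |x| < 1)
    {A : ℝ} (hint : IntegrableOn (dioph s x) (Ioi A)) :
    FEqualsSeries s x fun j =>
      phase x j * ((absProd x j ^ (s - 1 / 2) : ℝ) : ℂ) * Omega s (T^[j] x) := by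
  have hlimits : ∀ J, ∃ F : ℂ, Tendsto (partialF s (T^[J] x)) atTop (𝓝 F) ∧
      absProd x J ^ (s - 1 / 2) * ‖F‖ ≤
        8 * s * (2 * (∫ t in Ioi ((absProd x J)⁻¹ / 2), dioph s x t) +
          absProd x J ^ (s - 1 / 2) *
            ∑' k : ℕ, √(1 + Real.log (k + 1)) * ((k : ℝ) + 1) ^ (-(s + 1 / 2))) := fun J => by
    obtain ⟨a, b, c, d, h, -, hJ⟩ := exists_isOrbit hx hx1 J
    exact hJ ▸ h.exists_tendsto_partialF hs hint
  choose F hF hF_le using hlimits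
  have hx0 : ∀ J, T^[J] x ≠ 0 := fun J => by
    obtain ⟨_, _, _, _, h, -⟩ := exists_isOrbit hx hx1 J
    exact h.irrational.ne_zero
  have habsProd := tendsto_absProd hx hx1
  have hscale : Tendsto (fun J => (absProd x J)⁻¹ / 2) atTop atTop :=
    habsProd.inv_tendsto_nhdsGT_zero.atTop_div_const two_pos
  have hrpow : Tendsto (fun J => absProd x J ^ (s - 1 / 2)) atTop (𝓝 0) := by
    have := (tendsto_nhdsWithin_iff.1 habsProd).1.rpow_const (p := s - 1 / 2) (Or.inr (by linarith))
    rwa [Real.zero_rpow (by linarith)] at this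
  have hbound := (((tendsto_integral_Ioi_zero (μ := volume) (f := dioph s x) hscale).const_mul
    2).add (hrpow.mul_const
      (∑' k : ℕ, √(1 + Real.log (k + 1)) * ((k : ℝ) + 1) ^ (-(s + 1 / 2))))).const_mul (8 * s)
  rw [mul_zero, zero_mul, add_zero, mul_zero] at hbound
  exact fEqualsSeries_of_tendsto_partialF (by linarith) hx0 hF
    (squeeze_zero (fun J => by have := absProd_nonneg x J; positivity) hF_le hbound)

end Convergence

section ContinuedFraction

variable {x : ℝ}

theorem not_terminatedAt_of_irrational (hx : Irrational x) (n : ℕ) :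
    ¬(GenContFract.of x).TerminatedAt n := fun h =>
  let ⟨q, hq⟩ := (GenContFract.terminates_iff_rat x).1 ⟨n, h⟩
  hx ⟨q, hq.symm⟩

theorem fib_succ_le_Q (hx : Irrational x) (n : ℕ) : (Nat.fib (n + 1) : ℝ) ≤ Q x n :=
  GenContFract.succ_nth_fib_le_of_nth_den (Or.inr (not_terminatedAt_of_irrational hx _))

theorem one_le_Q (hx : Irrational x) (n : ℕ) : 1 ≤ Q x n :=
  le_trans (mod_cast Nat.fib_pos.2 n.succ_pos) (fib_succ_le_Q hx n)

theorem Q_pos (hx : Irrational x) (n : ℕ) : 0 < Q x n := zero_lt_one.trans_le (one_le_Q hx n)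

theorem log_Q_nonneg (hx : Irrational x) (n : ℕ) : 0 ≤ Real.log (Q x n) :=
  Real.log_nonneg (one_le_Q hx n)

theorem monotone_Q (x : ℝ) : Monotone (Q x) :=
  monotone_nat_of_le_succ fun _ => GenContFract.of_den_mono

theorem sqrt_two_pow_le_two_mul_fib_succ (n : ℕ) : √2 ^ n ≤ 2 * (Nat.fib (n + 1) : ℝ) := by
  induction n using Nat.twoStepInduction with
  | zero => simp
  | one => simp
  | more n ih _ =>
    have hdouble : 2 * Nat.fib (n + 1) ≤ Nat.fib (n + 2 + 1) := by
      have hadd : Nat.fib (n + 2 + 1) = Nat.fib (n + 1) + Nat.fib (n + 2) := Nat.fib_add_two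
      have hmono : Nat.fib (n + 1) ≤ Nat.fib (n + 2) := Nat.fib_le_fib_succ
      lia
    rw [pow_add, Real.sq_sqrt zero_le_two]
    have : 2 * (Nat.fib (n + 1) : ℝ) ≤ Nat.fib (n + 2 + 1) := by exact_mod_cast hdouble
    linarith

theorem sqrt_two_pow_div_two_le_Q (hx : Irrational x) (n : ℕ) : √2 ^ n / 2 ≤ Q x n := by
  linarith [sqrt_two_pow_le_two_mul_fib_succ n, fib_succ_le_Q hx n]

theorem tendsto_Q (hx : Irrational x) : Tendsto (Q x) atTop atTop :=
  tendsto_atTop_mono (sqrt_two_pow_div_two_le_Q hx)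
    ((tendsto_pow_atTop_atTop_of_one_lt Real.one_lt_sqrt_two).atTop_div_const two_pos)

theorem summable_Q_rpow (hx : Irrational x) {r : ℝ} (hr : r < 0) :
    Summable fun n => Q x n ^ r := by
  have hgeom := (summable_geometric_of_lt_one (by positivity)
    (Real.rpow_lt_one_of_one_lt_of_neg Real.one_lt_sqrt_two hr)).mul_right (2⁻¹ ^ r)
  refine Summable.of_nonneg_of_le (fun n => Real.rpow_nonneg (Q_pos hx n).le r) (fun n => ?_) hgeom
  refine (Real.rpow_le_rpow_of_nonpos (by positivity) (sqrt_two_pow_div_two_le_Q hx n)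
    hr.le).trans_eq ?_
  rw [div_eq_mul_inv, Real.mul_rpow (by positivity) (by positivity), Real.rpow_pow_comm
    (by positivity)]

theorem exists_int_contsAux_eq (hx : Irrational x) (n : ℕ) :
    (∃ p q : ℤ, (GenContFract.of x).contsAux n = ⟨p, q⟩) ∧
      ∃ p q : ℤ, (GenContFract.of x).contsAux (n + 1) = ⟨p, q⟩ := by
  induction n with
  | zero =>
    refine ⟨⟨1, 0, by simp [GenContFract.contsAux]⟩, ⌊x⌋, 1, ?_⟩
    simp [GenContFract.contsAux, GenContFract.of_h_eq_floor]
  | succ n ih =>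
    refine ⟨ih.2, ?_⟩
    obtain ⟨⟨p, q, hpq⟩, p', q', hpq'⟩ := ih
    obtain ⟨gp, hgp⟩ : ∃ gp, (GenContFract.of x).s.get? n = some gp :=
      Option.ne_none_iff_exists'.1 (not_terminatedAt_of_irrational hx n)
    obtain ⟨ha, z, hz⟩ := GenContFract.of_partNum_eq_one_and_exists_int_partDen_eq hgp
    refine ⟨z * p' + p, z * q' + q, ?_⟩
    rw [GenContFract.contsAux_recurrence hgp hpq hpq', ha, hz]
    push_cast
    rw [one_mul, one_mul]

theorem exists_int_nums_eq_and_Q_eq (hx : Irrational x) (n : ℕ) :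
    ∃ p q : ℤ, (GenContFract.of x).nums n = p ∧ Q x n = q := by
  obtain ⟨p, q, hpq⟩ := (exists_int_contsAux_eq hx n).2
  refine ⟨p, q, ?_, ?_⟩
  · rw [GenContFract.num_eq_conts_a, GenContFract.nth_cont_eq_succ_nth_contAux, hpq]
  · rw [Q, GenContFract.den_eq_conts_b, GenContFract.nth_cont_eq_succ_nth_contAux, hpq]

theorem isCoprime_of_sub_eq_neg_one_pow {a b c d : ℤ} {n : ℕ} (h : a * d - b * c = (-1) ^ n) :
    IsCoprime b a := by
  rcases neg_one_pow_eq_or ℤ n with hn | hn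
  · exact ⟨-c, d, by linear_combination h + hn⟩
  · exact ⟨c, -d, by linear_combination -h - hn⟩

theorem abs_mul_sub_eq_mul_abs_sub_div {a : ℝ} (ha : 0 < a) (x b : ℝ) :
    |a * x - b| = a * |x - b / a| := by
  rw [← abs_of_pos ha, ← abs_mul, abs_of_pos ha, mul_sub, mul_div_cancel₀ _ ha.ne']

theorem exists_isCoprime_and_abs_sub_le (hx : Irrational x) (n : ℕ) :
    ∃ (P : ℤ) (R : ℕ), Q x n = R ∧ IsCoprime (R : ℤ) P ∧ |R * x - P| ≤ 1 / Q x (n + 1) := by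
  obtain ⟨P, R, hP, hR⟩ := exists_int_nums_eq_and_Q_eq hx n
  obtain ⟨P', R', hP', hR'⟩ := exists_int_nums_eq_and_Q_eq hx (n + 1)
  have hR0 : (0 : ℝ) < R := hR ▸ Q_pos hx n
  lift R to ℕ using by exact_mod_cast hR0.le
  rw [Int.cast_natCast] at hR hR0
  have hdet : P * R' - R * P' = (-1) ^ (n + 1) := by
    have hdet : (GenContFract.of x).nums n * Q x (n + 1) - Q x n * (GenContFract.of x).nums (n + 1)
        = (-1) ^ (n + 1) :=
      SimpContFract.determinant (s := SimpContFract.of x) (not_terminatedAt_of_irrational hx n)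
    rw [hP, hR, hP', hR'] at hdet
    exact_mod_cast hdet
  have happrox : |x - (GenContFract.of x).nums n / Q x n| ≤ 1 / (Q x n * Q x (n + 1)) :=
    GenContFract.abs_sub_convs_le (not_terminatedAt_of_irrational hx n)
  refine ⟨P, R, hR, isCoprime_of_sub_eq_neg_one_pow hdet, ?_⟩
  calc |R * x - P| = R * |x - P / R| := abs_mul_sub_eq_mul_abs_sub_div hR0 x P
    _ ≤ R * (1 / (R * Q x (n + 1))) := by
        gcongr
        rwa [hP, hR] at happrox
    _ = 1 / Q x (n + 1) := by field_simp

theorem le_two_mul_of_isCoprime {P p : ℤ} {R q : ℕ} (hq : 0 < q) (hcop : IsCoprime (R : ℤ) P)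
    (hRx : R * |R * x - P| ≤ 1) (hqx : R * |q * x - p| ≤ 1 / 2) : R ≤ 2 * q := by
  by_contra! hlt
  have hne : p * R - q * P ≠ 0 := fun h => by
    have hdvd : (R : ℤ) ∣ q * P := ⟨p, by linear_combination -h⟩
    have := Int.le_of_dvd (mod_cast hq) (hcop.dvd_of_dvd_mul_right hdvd)
    lia
  have hlt' : 2 * (q : ℝ) < R := by exact_mod_cast hlt
  have : (0 : ℝ) < R := (mul_nonneg zero_le_two q.cast_nonneg).trans_lt hlt'
  have hhalf : 1 / 2 ≤ q * |R * x - P| := by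
    have hone : (1 : ℝ) ≤ |(p : ℝ) * R - q * P| := by exact_mod_cast Int.one_le_abs hne
    have hsplit : (p : ℝ) * R - q * P = q * (R * x - P) - R * (q * x - p) := by ring
    have habs := abs_sub ((q : ℝ) * (R * x - P)) (R * (q * x - p))
    rw [abs_mul, abs_mul, Nat.abs_cast, Nat.abs_cast] at habs
    rw [hsplit] at hone
    linarith
  nlinarith [q.cast_nonneg (α := ℝ)]

theorem Q_le_two_mul_minDen (hx : Irrational x) {n : ℕ} {M : ℝ} (hM : 2 * Q x n ≤ M) :
    Q x n ≤ 2 * minDen x M := by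
  have hQ := Q_pos hx n
  have hM0 : 0 < M := by linarith
  obtain ⟨P, R, hR, hcop, hRx⟩ := exists_isCoprime_and_abs_sub_le hx n
  obtain ⟨hone, hdist⟩ := minDen_spec x hM0
  rw [hR] at hQ hM ⊢
  have hRx' : R * |R * x - P| ≤ 1 := by
    refine (mul_le_mul_of_nonneg_left hRx hQ.le).trans ?_
    rw [mul_one_div, div_le_one (Q_pos hx _), ← hR]
    exact monotone_Q x n.le_succ
  have hqx : R * |minDen x M * x - round (minDen x M * x)| ≤ 1 / 2 := by
    refine (mul_le_mul_of_nonneg_left hdist hQ.le).trans ?_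
    rw [mul_one_div, div_le_div_iff₀ hM0 two_pos]
    linarith
  exact_mod_cast le_two_mul_of_isCoprime hone hcop hRx' hqx

end ContinuedFraction

section Summability

variable {s x : ℝ}

theorem dioph_two_mul_le (hs : 0 ≤ s) (hx : Irrational x) {n : ℕ} {t : ℝ} (ht : Q x n ≤ t) :
    dioph s x (2 * t) ≤ √2 / √(Q x n) * t ^ (-s) := by
  have hQ := Q_pos hx n
  have ht0 : 0 < t := hQ.trans_le ht
  have hminDen : 0 < (minDen x (2 * t) : ℝ) := by
    exact_mod_cast one_le_minDen x (mul_pos two_pos ht0)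
  have hsqrt : √(Q x n) ≤ √2 * √(minDen x (2 * t)) := by
    rw [← Real.sqrt_mul zero_le_two]
    exact Real.sqrt_le_sqrt (Q_le_two_mul_minDen hx (by linarith))
  calc dioph s x (2 * t) ≤ t ^ (-s) / √(minDen x (2 * t)) := by
        rw [dioph]
        gcongr ?_ / _
        exact Real.rpow_le_rpow_of_nonpos ht0 (by linarith) (by linarith)
    _ ≤ √2 / √(Q x n) * t ^ (-s) := by
        rw [div_mul_eq_mul_div, div_le_div_iff₀ (by positivity) (by positivity)]
        nlinarith [Real.rpow_nonneg ht0.le (-s)]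

theorem integrableOn_dioph (hs : 0 ≤ s) (hx : Irrational x)
    (h : Summable fun n => (∫ u in Q x n..Q x (n + 1), u ^ (-s)) / √(Q x n)) :
    IntegrableOn (dioph s x) (Ioi (2 * Q x 0)) := by
  rw [← integrableOn_Ioi_comp_mul_left_iff _ _ two_pos,
    ← show ⋃ n, Ioc (Q x n) (Q x (n + 1)) = Ioi (Q x 0) from
      iUnion_Ioc_map_succ_eq_Ioi (fun n => monotone_Q x n.zero_le)
        (not_bddAbove_of_tendsto_atTop (tendsto_Q hx))]
  have hpos : ∀ n, Icc (Q x n) (Q x (n + 1)) ⊆ Ioi 0 := fun n t ht => (Q_pos hx n).trans_le ht.1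
  have hint : ∀ n, IntegrableOn (fun t => dioph s x (2 * t)) (Icc (Q x n) (Q x (n + 1))) :=
    fun n => AntitoneOn.integrableOn_isCompact isCompact_Icc fun t ht u hu htu =>
      antitoneOn_dioph hs x (mem_Ioi.2 (mul_pos two_pos (hpos n ht)))
        (mem_Ioi.2 (mul_pos two_pos (hpos n hu))) (by gcongr)
  refine integrableOn_iUnion_of_summable_integral_norm
    (fun n => (hint n).mono_set Ioc_subset_Icc_self) ?_
  refine Summable.of_nonneg_of_le (fun n => integral_nonneg fun t => norm_nonneg _) (fun n => ?_)
    (h.mul_left √2)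
  have hle : Q x n ≤ Q x (n + 1) := monotone_Q x n.le_succ
  have hrpow : IntervalIntegrable (fun u : ℝ => u ^ (-s)) volume (Q x n) (Q x (n + 1)) :=
    intervalIntegral.intervalIntegrable_rpow <| Or.inr <| by
      rw [uIcc_of_le hle]
      exact fun h0 => lt_irrefl 0 (mem_Ioi.1 (hpos n h0))
  calc ∫ t in Ioc (Q x n) (Q x (n + 1)), ‖dioph s x (2 * t)‖
      ≤ ∫ t in Ioc (Q x n) (Q x (n + 1)), √2 / √(Q x n) * t ^ (-s) := by
        refine setIntegral_mono_on ((hint n).mono_set Ioc_subset_Icc_self).norm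
          (hrpow.1.const_mul _) measurableSet_Ioc fun t ht => ?_
        have ht0 := hpos n (Ioc_subset_Icc_self ht)
        rw [Real.norm_of_nonneg (dioph_nonneg (mem_Ioi.2 (mul_pos two_pos ht0)))]
        exact dioph_two_mul_le hs hx ht.1.le
    _ = √2 * ((∫ u in Q x n..Q x (n + 1), u ^ (-s)) / √(Q x n)) := by
        rw [integral_const_mul, intervalIntegral.integral_of_le hle, div_mul_eq_mul_div,
          mul_div_assoc]

theorem integral_rpow_neg_le {a b : ℝ} (hs : -1 ≤ s) (hs3 : s < 3) (ha : 0 < a) (hab : a ≤ b) :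
    ∫ u in a..b, u ^ (-s) ≤ 2 / (3 - s) * (b ^ ((3 - s) / 2) / a ^ ((1 + s) / 2)) := by
  have h0 : (0 : ℝ) ∉ uIcc a b := by
    rw [uIcc_of_le hab]
    exact fun h => h.1.not_gt ha
  calc ∫ u in a..b, u ^ (-s) ≤ ∫ u in a..b, a ^ (-((1 + s) / 2)) * u ^ ((1 - s) / 2) := by
        refine intervalIntegral.integral_mono_on hab
          (intervalIntegral.intervalIntegrable_rpow (Or.inr h0))
          ((intervalIntegral.intervalIntegrable_rpow (Or.inr h0)).const_mul _) fun u hu => ?_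
        have hu0 : 0 < u := ha.trans_le hu.1
        rw [show -s = -((1 + s) / 2) + (1 - s) / 2 by ring, Real.rpow_add hu0]
        gcongr ?_ * _
        exact Real.rpow_le_rpow_of_nonpos ha hu.1 (by linarith)
    _ = 2 / (3 - s) * ((b ^ ((3 - s) / 2) - a ^ ((3 - s) / 2)) / a ^ ((1 + s) / 2)) := by
        rw [intervalIntegral.integral_const_mul, integral_rpow (Or.inl (by linarith)),
          show (1 - s) / 2 + 1 = (3 - s) / 2 by ring, Real.rpow_neg ha.le]
        field_simp
    _ ≤ _ := by
        have : 0 < 3 - s := by linarith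
        gcongr
        exact sub_le_self _ (by positivity)

theorem integral_rpow_neg_nonneg {a b : ℝ} (ha : 0 < a) (hab : a ≤ b) :
    0 ≤ ∫ u in a..b, u ^ (-s) :=
  intervalIntegral.integral_nonneg hab fun _ hu => Real.rpow_nonneg (ha.le.trans hu.1) _

theorem summable_integral_of_summable_rpow (hs : -1 ≤ s) (hs3 : s < 3) (hx : Irrational x)
    (h : Summable fun n => Q x (n + 2) ^ ((3 - s) / 2) / Q x (n + 1) ^ (1 + s / 2)) :
    Summable fun n => (∫ u in Q x n..Q x (n + 1), u ^ (-s)) / √(Q x n) := by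
  refine (summable_nat_add_iff 1).1 (Summable.of_nonneg_of_le (fun n => ?_) (fun n => ?_)
    (h.mul_left (2 / (3 - s))))
  · exact div_nonneg (integral_rpow_neg_nonneg (Q_pos hx _) (monotone_Q x (Nat.le_succ _)))
      (Real.sqrt_nonneg _)
  · have hQ := Q_pos hx (n + 1)
    refine (div_le_div_of_nonneg_right (integral_rpow_neg_le hs hs3 hQ
      (monotone_Q x (Nat.le_succ _))) (Real.sqrt_nonneg _)).trans_eq ?_
    rw [show 1 + s / 2 = (1 + s) / 2 + 1 / 2 by ring, Real.rpow_add hQ, ← Real.sqrt_eq_rpow]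
    field_simp

theorem summable_integral_of_summable_log (hx : Irrational x)
    (h : Summable fun n => Real.log (Q x (n + 2)) / √(Q x n) +
      Q x (n + 2) * Real.log (Q x (n + 2)) ^ 2 / Q x (n + 1) ^ (3 / 2 : ℝ)) :
    Summable fun n => (∫ u in Q x n..Q x (n + 1), u ^ (-1 : ℝ)) / √(Q x n) := by
  refine (summable_nat_add_iff 1).1 (Summable.of_nonneg_of_le (fun n => ?_) (fun n => ?_) h)
  · exact div_nonneg (integral_rpow_neg_nonneg (Q_pos hx _) (monotone_Q x (Nat.le_succ _)))
      (Real.sqrt_nonneg _)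
  · have hQ := Q_pos hx n
    have hQ1 := Q_pos hx (n + 1)
    have hQ2 := Q_pos hx (n + 2)
    have hlog := log_Q_nonneg hx (n + 2)
    calc (∫ u in Q x (n + 1)..Q x (n + 2), u ^ (-1 : ℝ)) / √(Q x (n + 1))
        ≤ Real.log (Q x (n + 2)) / √(Q x n) := by
          gcongr
          · simp_rw [Real.rpow_neg_one]
            rw [integral_inv_of_pos hQ1 hQ2, Real.log_div hQ2.ne' hQ1.ne']
            exact sub_le_self _ (log_Q_nonneg hx _)
          · exact monotone_Q x n.le_succ
      _ ≤ _ := le_add_of_nonneg_right (by positivity)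

theorem finite_setOf_abs_sub_div_lt {r : ℝ} (hr : 1 ≤ r) (h : irrationalityExponent x < r) :
    {q : ℕ | 1 ≤ q ∧ ∃ p : ℤ, |x - (p : ℝ) / q| < 1 / (q : ℝ) ^ r}.Finite := by
  contrapose! h
  exact le_sSup ⟨r, ⟨hr, h⟩, rfl⟩

theorem exists_lt_eventually_Q_succ_le (hx : Irrational x) {r : ℝ} (hr : 0 < r)
    (h : irrationalityExponent x < ((1 + r : ℝ) : EReal)) :
    ∃ r' < r, ∀ᶠ n in atTop, Q x (n + 1) ≤ Q x n ^ r' := by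
  obtain ⟨ν, hlt, hνr⟩ := EReal.lt_iff_exists_real_btwn.1
    (max_lt h (EReal.coe_lt_coe_iff.2 (lt_add_of_pos_right 1 hr)))
  rw [max_lt_iff] at hlt
  obtain ⟨B, hB⟩ := (finite_setOf_abs_sub_div_lt (EReal.coe_lt_coe_iff.1 hlt.2).le hlt.1).bddAbove
  refine ⟨ν - 1, by linarith [EReal.coe_lt_coe_iff.1 hνr], ?_⟩
  filter_upwards [(tendsto_Q hx).eventually_gt_atTop (B : ℝ)] with n hn
  obtain ⟨P, R, hR, -, hRx⟩ := exists_isCoprime_and_abs_sub_le hx n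
  have hQ1 := Q_pos hx (n + 1)
  rw [hR] at hn ⊢
  have hR0 : (0 : ℝ) < R := hR ▸ Q_pos hx n
  have hfar : 1 / (R : ℝ) ^ ν ≤ |x - P / R| := by
    by_contra! hnear
    exact (hB ⟨by exact_mod_cast hR0, P, hnear⟩).not_gt (by exact_mod_cast hn)
  have hle : R * (1 / (R : ℝ) ^ ν) ≤ 1 / Q x (n + 1) := by
    rw [abs_mul_sub_eq_mul_abs_sub_div hR0] at hRx
    exact (mul_le_mul_of_nonneg_left hfar hR0.le).trans hRx
  rw [mul_one_div, div_le_div_iff₀ (by positivity) hQ1] at hle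
  rw [Real.rpow_sub_one hR0.ne', le_div_iff₀ hR0]
  linarith

theorem summable_rpow_of_irrationalityExponent_lt (hs : -2 < s) (hs3 : s < 3) (hx : Irrational x)
    (h : irrationalityExponent x < ((1 + (2 + s) / (3 - s) : ℝ) : EReal)) :
    Summable fun n => Q x (n + 2) ^ ((3 - s) / 2) / Q x (n + 1) ^ (1 + s / 2) := by
  have h3s : 0 < 3 - s := by linarith
  obtain ⟨r, hr, hQ_le⟩ := exists_lt_eventually_Q_succ_le hx (div_pos (by linarith) h3s) h
  rw [lt_div_iff₀ h3s] at hr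
  refine Summable.of_norm_bounded_eventually_nat ((summable_nat_add_iff 1).2
    (summable_Q_rpow hx (r := r * ((3 - s) / 2) - (1 + s / 2)) (by linarith))) ?_
  filter_upwards [(tendsto_add_atTop_nat 1).eventually hQ_le] with n hn
  have hQ1 := Q_pos hx (n + 1)
  have hQ2 := Q_pos hx (n + 2)
  rw [Real.norm_of_nonneg (by positivity), Real.rpow_sub hQ1, Real.rpow_mul hQ1.le]
  gcongr

theorem isBigO_log_Q_rpow (hx : Irrational x) {ε : ℝ} (hε : 0 < ε) :
    (fun n => Real.log (Q x n)) =O[atTop] fun n => Q x n ^ ε :=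
  (isLittleO_log_rpow_atTop hε).isBigO.comp_tendsto (tendsto_Q hx)

theorem isBigO_log_Q_succ (hx : Irrational x) {r : ℝ}
    (h : ∀ᶠ n in atTop, Q x (n + 1) ≤ Q x n ^ r) :
    (fun n => Real.log (Q x (n + 1))) =O[atTop] fun n => Real.log (Q x n) := by
  refine IsBigO.of_bound r ?_
  filter_upwards [h] with n hn
  rw [Real.norm_of_nonneg (log_Q_nonneg hx _), Real.norm_of_nonneg (log_Q_nonneg hx _),
    ← Real.log_rpow (Q_pos hx n)]
  exact Real.log_le_log (Q_pos hx _) hn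

theorem summable_log_Q_div_sqrt (hx : Irrational x) {r : ℝ}
    (h : ∀ᶠ n in atTop, Q x (n + 1) ≤ Q x n ^ r) :
    Summable fun n => Real.log (Q x (n + 2)) / √(Q x n) := by
  have hlog : (fun n => Real.log (Q x (n + 2))) =O[atTop] fun n => Q x n ^ (1 / 4 : ℝ) :=
    ((isBigO_log_Q_succ hx h).comp_tendsto (tendsto_add_atTop_nat 1)).trans
      ((isBigO_log_Q_succ hx h).trans (isBigO_log_Q_rpow hx (by norm_num)))
  refine summable_of_isBigO_nat (summable_Q_rpow hx (r := 1 / 4 - 1 / 2) (by norm_num)) ?_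
  simp_rw [Real.rpow_sub (Q_pos hx _), ← Real.sqrt_eq_rpow, div_eq_mul_inv _ √_]
  exact hlog.mul (isBigO_refl _ _)

theorem summable_Q_mul_log_sq_div_rpow (hx : Irrational x) {r : ℝ} (hr : r < 3 / 2)
    (h : ∀ᶠ n in atTop, Q x (n + 1) ≤ Q x n ^ r) :
    Summable fun n =>
      Q x (n + 2) * Real.log (Q x (n + 2)) ^ 2 / Q x (n + 1) ^ (3 / 2 : ℝ) := by
  have hQ : (fun n => Q x (n + 1)) =O[atTop] fun n => Q x n ^ r :=
    IsBigO.of_norm_eventuallyLE (h.mono fun n hn => by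
      simpa only [Real.norm_of_nonneg (Q_pos hx _).le] using hn)
  have hlog : (fun n => Real.log (Q x (n + 1))) =O[atTop] fun n => Q x n ^ ((3 / 2 - r) / 4) :=
    (isBigO_log_Q_succ hx h).trans (isBigO_log_Q_rpow hx (by linarith))
  suffices Summable fun n => Q x (n + 1) * Real.log (Q x (n + 1)) ^ 2 / Q x n ^ (3 / 2 : ℝ) from
    (summable_nat_add_iff 1).2 this
  refine summable_of_isBigO_nat (summable_Q_rpow hx (r := -((3 / 2 - r) / 2)) (by linarith)) ?_
  refine ((hQ.mul (hlog.pow 2)).mul (isBigO_refl (fun n => (Q x n ^ (3 / 2 : ℝ))⁻¹) _)).congr_right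
    fun n => ?_
  rw [← Real.rpow_natCast, ← Real.rpow_mul (Q_pos hx n).le, ← Real.rpow_neg (Q_pos hx n).le,
    ← Real.rpow_add (Q_pos hx n), ← Real.rpow_add (Q_pos hx n)]
  ring_nf

theorem summable_log_of_irrationalityExponent_lt (hx : Irrational x)
    (h : irrationalityExponent x < ((5 / 2 : ℝ) : EReal)) :
    Summable fun n => Real.log (Q x (n + 2)) / √(Q x n) +
      Q x (n + 2) * Real.log (Q x (n + 2)) ^ 2 / Q x (n + 1) ^ (3 / 2 : ℝ) := by
  rw [show (5 / 2 : ℝ) = 1 + 3 / 2 by norm_num] at h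
  obtain ⟨r, hr, hQ_le⟩ := exists_lt_eventually_Q_succ_le hx (by norm_num) h
  exact (summable_log_Q_div_sqrt hx hQ_le).add (summable_Q_mul_log_sq_div_rpow hx hr hQ_le)

end Summability

end ThetaSeries

end

open ThetaSeries in
theorem corollary4_general {s x : ℝ} (hs : 1 / 2 < s) (hx : Irrational x)
    (hx1 : x ∈ Set.Ioo (-1 : ℝ) 1)
    (h : Summable fun n => (∫ u in Q x n..Q x (n + 1), u ^ (-s)) / √(Q x n)) :
    FEqualsSeries s x fun j =>
      phase x j * ((absProd x j ^ (s - 1 / 2) : ℝ) : ℂ) * Omega s (T^[j] x) :=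
  fEqualsSeries_of_integrableOn_dioph hs hx (abs_lt.2 hx1)
    (integrableOn_dioph (by linarith) hx h)

theorem corollary4 :
    (∀ s : ℝ, 1 / 2 < s → s < 1 →
      (∀ x : ℝ, Irrational x → x ∈ Set.Ioo (-1 : ℝ) 1 →
        Summable (fun n : ℕ =>
          ThetaSeries.Q x (n + 2) ^ ((3 - s) / 2) / ThetaSeries.Q x (n + 1) ^ (1 + s / 2)) →
        ThetaSeries.FEqualsSeries s x (fun j : ℕ =>
          ThetaSeries.phase x j * ((ThetaSeries.absProd x j ^ (s - 1 / 2) : ℝ) : ℂ) *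
            ThetaSeries.Omega s (ThetaSeries.T^[j] x))) ∧
      (∀ x : ℝ, Irrational x →
        ThetaSeries.irrationalityExponent x < ((1 + (2 + s) / (3 - s) : ℝ) : EReal) →
        Summable (fun n : ℕ =>
          ThetaSeries.Q x (n + 2) ^ ((3 - s) / 2) / ThetaSeries.Q x (n + 1) ^ (1 + s / 2)))) ∧
    ((∀ x : ℝ, Irrational x → x ∈ Set.Ioo (-1 : ℝ) 1 →
        Summable (fun n : ℕ =>
          Real.log (ThetaSeries.Q x (n + 2)) / √(ThetaSeries.Q x n) +
            ThetaSeries.Q x (n + 2) * Real.log (ThetaSeries.Q x (n + 2)) ^ 2 /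
              ThetaSeries.Q x (n + 1) ^ (3 / 2 : ℝ)) →
        ThetaSeries.FEqualsSeries 1 x (fun j : ℕ =>
          ThetaSeries.phase x j * ((√(ThetaSeries.absProd x j) : ℝ) : ℂ) *
            ThetaSeries.Omega 1 (ThetaSeries.T^[j] x))) ∧
      (∀ x : ℝ, Irrational x →
        ThetaSeries.irrationalityExponent x < ((5 / 2 : ℝ) : EReal) →
        Summable (fun n : ℕ =>
          Real.log (ThetaSeries.Q x (n + 2)) / √(ThetaSeries.Q x n) +
            ThetaSeries.Q x (n + 2) * Real.log (ThetaSeries.Q x (n + 2)) ^ 2 /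
              ThetaSeries.Q x (n + 1) ^ (3 / 2 : ℝ)))) := by
  refine ⟨fun s hs hs1 => ⟨fun x hx hx1 h => ?_, fun x hx h => ?_⟩, fun x hx hx1 h => ?_,
    fun x hx h => ThetaSeries.summable_log_of_irrationalityExponent_lt hx h⟩
  · exact corollary4_general hs hx hx1
      (ThetaSeries.summable_integral_of_summable_rpow (by linarith) (by linarith) hx h)
  · exact ThetaSeries.summable_rpow_of_irrationalityExponent_lt (by linarith) (by linarith) hx h
  · have hF := corollary4_general (s := 1) (by norm_num) hx hx1
      (ThetaSeries.summable_integral_of_summable_log hx h)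
    simpa only [Real.sqrt_eq_rpow, show (1 : ℝ) - 1 / 2 = 1 / 2 by norm_num] using hF
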